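/- **Proposition 2.2.** Let $\lambda>0$, $\delta>0$, $\gamma\ge 0$. Let $B$ be a standard Brownian motion and $N$ a Poisson process with rate $\lambda$, independent of $B$. Let $G(t)=\inf\{s>0: B(s)+\gamma s>\delta t\}$ be the inverse Gaussian subordinator, and let $H(t)=\inf\{s\ge 0: G(s)>t\}$ be its first hitting time process. Put $p_k(t)=\mathbb P(N(t)=k)$ and $\tilde p_k(t)=\mathbb P(N(H(t))=k)$ for $t\ge 0$, with $\tilde p_{-1}=\tilde p_{-2}=0$. For every $t>0$ the random variable $H(t)$ has a density $h(\cdot,t)$ that is continuous on $[0,\infty)$, and $t\mapsto h(0,t)$ is integrable on $(0,T]$ for every $T>0$. For $k\ge 0$ and $t>0$ put $$R_k(t)=\frac1{2\delta^2}\Big[(\lambda^2-2\delta\gamma\lambda)\,\tilde p_k(t)+(-2\lambda^2+2\delta\gamma\lambda)\,\tilde p_{k-1}(t)+\lambda^2\,\tilde p_{k-2}(t)\Big]+\frac1{2\delta^2}\,h(0,t)\,p_k'(0),$$ where $p_k'(0)$ is the right derivative at $0$, equal to $-\lambda$ for $k=0$, to $\lambda$ for $k=1$ and to $0$ for $k\ge2$.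 Then for every $k\ge 0$: 1. for every $t>0$, $\tilde p_k$ is differentiable at $t$ and $\frac{d}{dt}\tilde p_k(t)=R_k(t)$; 2. in the sense of distributions on $\mathbb R$, with $\tilde p_k$ and $R_k$ extended by $0$ to $t<0$, $$\frac{d}{dt}\tilde p_k-\delta_0(t)\,\tilde p_k(0)=R_k,$$ that is, $-\int_0^\infty \tilde p_k(t)\varphi'(t)\,dt-\tilde p_k(0)\varphi(0)=\int_0^\infty R_k(t)\varphi(t)\,dt$ for all $\varphi\in C_c^\infty(\mathbb R)$. -/

import Mathlib

open MeasureTheory ProbabilityTheory Set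
open scoped NNReal

noncomputable section

namespace IGHitting

variable {Ω : Type*} [MeasurableSpace Ω]

/-- A (homogeneous) Poisson process with rate `lam`: it starts at `0`, its paths are nondecreasing
and right-continuous, and its increments are independent and Poisson distributed. (As the paths are
nondecreasing, the truncated subtraction of `ℕ` is the true difference.) -/
structure IsPoissonProcess (N : ℝ≥0 → Ω → ℕ) (lam : ℝ≥0) (P : Measure Ω) : Prop where
  eval_zero : ∀ᵐ ω ∂P, N 0 ω = 0
  monotone : ∀ᵐ ω ∂P, Monotone (fun t ↦ N t ω)
  rightCont : ∀ᵐ ω ∂P, ∀ t, ContinuousWithinAt (fun s ↦ N s ω) (Ici t) t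
  indepIncrements : HasIndepIncrements N P
  hasLaw_sub : ∀ s t, s ≤ t → HasLaw (fun ω ↦ N t ω - N s ω) (poissonMeasure (lam * (t - s))) P

/-- The inverse Gaussian subordinator `G(t) = inf {s > 0 : B(s) + γ s > δ t}`. For `γ ≥ 0` and a
Brownian motion `B` the set is almost surely nonempty for all `t`. -/
def igSubordinator (B : ℝ≥0 → Ω → ℝ) (δ γ : ℝ) (t : ℝ≥0) (ω : Ω) : ℝ≥0 :=
  sInf {s : ℝ≥0 | 0 < s ∧ δ * t < B s ω + γ * s}

/-- The first hitting time process `H(t) = inf {s ≥ 0 : G(s) > t}` of a process `G`. -/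
def firstHitting (G : ℝ≥0 → Ω → ℝ≥0) (t : ℝ≥0) (ω : Ω) : ℝ≥0 :=
  sInf {s : ℝ≥0 | t < G s ω}

/-- The first hitting time process of the inverse Gaussian subordinator. -/
def igHitting (B : ℝ≥0 → Ω → ℝ) (δ γ : ℝ) (t : ℝ≥0) (ω : Ω) : ℝ≥0 :=
  firstHitting (igSubordinator B δ γ) t ω

/-- The probability mass function of `N(t)`, `t ≥ 0`, at an integer `k` (it vanishes for
`k < 0`). -/
def pmfProcess (N : ℝ≥0 → Ω → ℕ) (P : Measure Ω) (k : ℤ) (t : ℝ) : ℝ :=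
  P.real {ω | (N t.toNNReal ω : ℤ) = k}

/-- The process `N` time-changed by the process `H`. -/
def timeChange (N : ℝ≥0 → Ω → ℕ) (H : ℝ≥0 → Ω → ℝ≥0) (t : ℝ≥0) (ω : Ω) : ℕ :=
  N (H t ω) ω

/-- `f` is a version of the density of the nonnegative random variable `X` that is nonnegative and
continuous on `[0, ∞)`. Such an `f` is unique on `[0, ∞)`. -/
structure IsContinuousDensity (f : ℝ → ℝ) (X : Ω → ℝ≥0) (P : Measure Ω) : Prop where
  nonneg : ∀ x, 0 ≤ x → 0 ≤ f x
  continuousOn : ContinuousOn f (Ici 0)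
  hasLaw : HasLaw (fun ω ↦ (X ω : ℝ))
    ((volume.restrict (Ici 0)).withDensity (fun x ↦ ENNReal.ofReal (f x))) P

/-- The values `p_k'(0)`: `-lam` for `k = 0`, `lam` for `k = 1` and `0` for `k ≥ 2`. -/
def pmfDerivZero (lam : ℝ) (k : ℕ) : ℝ :=
  if k = 0 then -lam else if k = 1 then lam else 0

/-- The part of the right side of the equation without the Dirac term, for the mass functions `q`
and the boundary values `h₀ t = h(0, t)`. -/
def ddeRight (lam δ γ : ℝ) (q : ℤ → ℝ → ℝ) (h₀ : ℝ → ℝ) (k : ℕ) (t : ℝ) : ℝ :=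
  1 / (2 * δ ^ 2) * ((lam ^ 2 - 2 * δ * γ * lam) * q k t
    + (-2 * lam ^ 2 + 2 * δ * γ * lam) * q (k - 1) t + lam ^ 2 * q (k - 2) t)
  + 1 / (2 * δ ^ 2) * h₀ t * pmfDerivZero lam k

end IGHitting

end

noncomputable section

open Filter Topology

namespace IGHitting

/-! Write X(s) = B(s) + γs. Since G(s) > t essentially means that X has stayed below the level δs up
to time t, H(t) is the running maximum of X on [0, t] divided by δ (`lt_igHitting_iff`). The
reflection principle, with an exponential weight that accounts for the drift, gives the law of this
maximum (`measure_exists_lt_drifted`); differentiating its tail gives the explicit density f(t, m) =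
`maxPDF γ t m`.

This density solves the forward equation ∂f/∂t = ½ f'' - γ f' on m > 0 with zero flux at the
boundary, f'(t, 0) = 2γ f(t, 0). Integration by parts against a bounded test function p therefore
gives d/dt ∫ p f = ∫ (½ p'' + γ p') f + ½ f(t, 0) p'(0) (`hasDerivAt_integral_mul_maxPDF`).

Independence of N and B gives P(N(H(t)) = k) = E p_k(H(t))
(`IsPoissonProcess.measureReal_timeChange`), so the test function to use is m ↦ p_k(m/δ). The
recursion p_k' = λ(p_{k-1} - p_k) turns ½ p'' + γ p' into the stated combination of indices k, k-1,
k-2, and h(0, t) = δ f(t, 0) turns the boundary term into the stated one.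

The distributional form follows by integrating by parts in time: h(0, t) is O(t^{-1/2}), hence
integrable near 0, and the mass functions are continuous at 0, so the only boundary contribution is
the Dirac term. -/

/-! ### The tail of the standard Gaussian law -/

/-- The standard Gaussian density. -/
def stdPDF (z : ℝ) : ℝ := (√(2 * Real.pi))⁻¹ * Real.exp (-z ^ 2 / 2)

/-- The tail of the standard Gaussian law. -/
def stdTail (z : ℝ) : ℝ := (gaussianReal 0 1).real (Ioi z)

lemma stdPDF_eq (z : ℝ) : stdPDF z = gaussianPDFReal 0 1 z := by
  simp [stdPDF, gaussianPDFReal]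

lemma stdPDF_nonneg (z : ℝ) : 0 ≤ stdPDF z := by unfold stdPDF; positivity

lemma integrable_stdPDF : Integrable stdPDF := by
  rw [show stdPDF = gaussianPDFReal 0 1 from funext stdPDF_eq]
  exact integrable_gaussianPDFReal 0 1

lemma continuous_stdPDF : Continuous stdPDF := by unfold stdPDF; fun_prop

lemma stdTail_eq_integral (z : ℝ) : stdTail z = ∫ u in Ioi z, stdPDF u := by
  rw [stdTail, measureReal_def, gaussianReal_apply_eq_integral _ one_ne_zero, ENNReal.toReal_ofReal]
  · simp_rw [stdPDF_eq]
  · exact setIntegral_nonneg measurableSet_Ioi fun x _ ↦ gaussianPDFReal_nonneg _ _ _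

lemma stdTail_nonneg (z : ℝ) : 0 ≤ stdTail z := measureReal_nonneg

lemma stdTail_add_stdTail_neg (z : ℝ) : stdTail z + stdTail (-z) = 1 := by
  have h1 : stdTail (-z) = (gaussianReal 0 1).real (Iio z) := by
    have : (gaussianReal 0 1).map (fun x ↦ -x) = gaussianReal 0 1 := by
      simpa using gaussianReal_map_neg (μ := 0) (v := 1)
    rw [← this, map_measureReal_apply measurable_neg measurableSet_Iio, stdTail]
    congr 1
    ext x
    simp
  have : NullSingletonClass (gaussianReal 0 1) := nullSingletonClass_gaussianReal one_ne_zero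
  rw [h1, stdTail, measureReal_congr (Iio_ae_eq_Iic (a := z)), ← compl_Ioi,
    probReal_compl_eq_one_sub measurableSet_Ioi]
  ring

lemma hasDerivAt_stdTail (z : ℝ) : HasDerivAt stdTail (-stdPDF z) z := by
  have h (y : ℝ) : stdTail y = stdTail z - ∫ u in z..y, stdPDF u := by
    rw [stdTail_eq_integral, stdTail_eq_integral]
    rcases le_total z y with hy | hy
    · rw [← intervalIntegral.integral_Ioi_sub_Ioi integrable_stdPDF.integrableOn hy]
      ring
    · rw [intervalIntegral.integral_symm,
        ← intervalIntegral.integral_Ioi_sub_Ioi integrable_stdPDF.integrableOn hy]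
      ring
  rw [show stdTail = fun y ↦ stdTail z - ∫ u in z..y, stdPDF u from funext h]
  exact (intervalIntegral.integral_hasDerivAt_right (continuous_stdPDF.intervalIntegrable _ _)
    continuous_stdPDF.stronglyMeasurable.stronglyMeasurableAtFilter
    continuous_stdPDF.continuousAt).const_sub _

lemma hasDerivAt_stdPDF (z : ℝ) : HasDerivAt stdPDF (-z * stdPDF z) z := by
  unfold stdPDF
  convert! ((((hasDerivAt_id z).pow 2).neg.div_const 2).exp.const_mul (√(2 * Real.pi))⁻¹) using 1
  simp
  ring

lemma tendsto_stdPDF : Tendsto stdPDF atTop (𝓝 0) := by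
  unfold stdPDF
  rw [← mul_zero (√(2 * Real.pi))⁻¹]
  refine (Real.tendsto_exp_atBot.comp ?_).const_mul _
  simp_rw [neg_div]
  exact tendsto_neg_atTop_atBot.comp ((tendsto_pow_atTop two_ne_zero).atTop_div_const two_pos)

/-- Mills' inequality. -/
lemma mul_stdTail_le {z : ℝ} (hz : 0 ≤ z) : z * stdTail z ≤ stdPDF z := by
  have hd (x : ℝ) : HasDerivAt (fun u ↦ -stdPDF u) (x * stdPDF x) x := by
    convert! (hasDerivAt_stdPDF x).neg using 1
    ring
  have hlim : Tendsto (fun u ↦ -stdPDF u) atTop (𝓝 0) := by simpa using tendsto_stdPDF.neg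
  have hnn : ∀ x ∈ Ioi z, 0 ≤ x * stdPDF x := fun x hx ↦
    mul_nonneg (hz.trans (le_of_lt hx)) (stdPDF_nonneg x)
  have hint : IntegrableOn (fun x ↦ x * stdPDF x) (Ioi z) :=
    integrableOn_Ioi_deriv_of_nonneg' (fun x _ ↦ hd x) hnn hlim
  have h := integral_Ioi_of_hasDerivAt_of_tendsto' (fun x _ ↦ hd x) hint hlim
  rw [zero_sub, neg_neg] at h
  rw [← h, stdTail_eq_integral, ← integral_const_mul]
  exact setIntegral_mono_on (integrable_stdPDF.integrableOn.const_mul z) hint measurableSet_Ioi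
    fun x hx ↦ mul_le_mul_of_nonneg_right (le_of_lt hx) (stdPDF_nonneg x)

/-! ### The density of the running maximum of a Brownian motion with drift -/

/-- The density at `m` of a Brownian motion with drift `γ` at time `t`. -/
def driftPDF (γ t m : ℝ) : ℝ := (√(2 * Real.pi * t))⁻¹ * Real.exp (-(m - γ * t) ^ 2 / (2 * t))

/-- The part of the tail of the running maximum that comes from reflected paths. -/
def reflTail (γ t m : ℝ) : ℝ := Real.exp (2 * γ * m) * stdTail ((m + γ * t) / √t)

/-- The tail of the running maximum. -/
def maxTail (γ t m : ℝ) : ℝ := stdTail ((m - γ * t) / √t) + reflTail γ t m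

/-- The density of the running maximum. -/
def maxPDF (γ t m : ℝ) : ℝ := 2 * driftPDF γ t m - 2 * γ * reflTail γ t m

/-- The derivative of the density of the running maximum in space. -/
def maxPDFDeriv (γ t m : ℝ) : ℝ :=
  2 * (-(m - γ * t) / t * driftPDF γ t m) - 2 * γ * (2 * γ * reflTail γ t m - driftPDF γ t m)

/-- The derivative of the density of the running maximum in time. -/
def maxPDFTime (γ t m : ℝ) : ℝ :=
  driftPDF γ t m * (((m - γ * t) / t) ^ 2 - 1 / t + γ * (m - γ * t) / t)

section Density

variable {γ t : ℝ}

lemma driftPDF_nonneg (γ t m : ℝ) : 0 ≤ driftPDF γ t m := by unfold driftPDF; positivity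

lemma reflTail_nonneg (γ t m : ℝ) : 0 ≤ reflTail γ t m :=
  mul_nonneg (Real.exp_pos _).le (stdTail_nonneg _)

lemma driftPDF_eq_stdPDF (ht : 0 < t) (m : ℝ) :
    driftPDF γ t m = stdPDF ((m - γ * t) / √t) / √t := by
  unfold driftPDF stdPDF
  rw [Real.sqrt_mul (by positivity), div_pow, Real.sq_sqrt ht.le]
  have : -((m - γ * t) ^ 2 / t) / 2 = -(m - γ * t) ^ 2 / (2 * t) := by ring
  rw [this, mul_inv]
  ring

/-- Completing the square, (m - γt)² = (m + γt)² - 4γmt. Because of this identity the Gaussian terms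
in the derivatives of both summands of `maxTail` coincide, whence the factor 2 in `maxPDF`. -/
lemma driftPDF_eq_exp_mul_stdPDF (ht : 0 < t) (m : ℝ) :
    driftPDF γ t m = Real.exp (2 * γ * m) * stdPDF ((m + γ * t) / √t) / √t := by
  unfold driftPDF stdPDF
  rw [Real.sqrt_mul (by positivity), div_pow, Real.sq_sqrt ht.le]
  have : -(m - γ * t) ^ 2 / (2 * t) = 2 * γ * m + -((m + γ * t) ^ 2 / t) / 2 := by
    field_simp; ring
  rw [this, mul_inv, Real.exp_add]
  ring

lemma hasDerivAt_driftPDF (γ t m : ℝ) :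
    HasDerivAt (driftPDF γ t) (-(m - γ * t) / t * driftPDF γ t m) m := by
  unfold driftPDF
  convert! (((((hasDerivAt_id m).sub_const (γ * t)).pow 2).neg.div_const
    (2 * t)).exp.const_mul (√(2 * Real.pi * t))⁻¹) using 1
  rcases eq_or_ne t 0 with rfl | ht
  · simp
  · simp
    field_simp
    ring

lemma hasDerivAt_reflTail (ht : 0 < t) (m : ℝ) :
    HasDerivAt (reflTail γ t) (2 * γ * reflTail γ t m - driftPDF γ t m) m := by
  have h1 : HasDerivAt (fun m ↦ stdTail ((m + γ * t) / √t))
      (-stdPDF ((m + γ * t) / √t) * (1 / √t)) m :=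
    (hasDerivAt_stdTail _).comp m (((hasDerivAt_id m).add_const (γ * t)).div_const √t)
  have h2 : HasDerivAt (fun m ↦ Real.exp (2 * γ * m)) (Real.exp (2 * γ * m) * (2 * γ)) m := by
    simpa using ((hasDerivAt_id m).const_mul (2 * γ)).exp
  convert! h2.mul h1 using 1
  rw [driftPDF_eq_exp_mul_stdPDF ht, reflTail]
  ring

lemma hasDerivAt_maxTail (ht : 0 < t) (m : ℝ) :
    HasDerivAt (maxTail γ t) (-maxPDF γ t m) m := by
  have h1 : HasDerivAt (fun m ↦ stdTail ((m - γ * t) / √t))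
      (-stdPDF ((m - γ * t) / √t) * (1 / √t)) m :=
    (hasDerivAt_stdTail _).comp m (((hasDerivAt_id m).sub_const (γ * t)).div_const √t)
  convert! h1.add (hasDerivAt_reflTail ht m) using 1
  rw [maxPDF, driftPDF_eq_stdPDF ht]
  ring

lemma hasDerivAt_maxPDF (ht : 0 < t) (m : ℝ) :
    HasDerivAt (maxPDF γ t) (maxPDFDeriv γ t m) m :=
  ((hasDerivAt_driftPDF γ t m).const_mul 2).sub ((hasDerivAt_reflTail ht m).const_mul (2 * γ))

/-- Together with `hasDerivAt_maxPDF_time`, this is the forward equation ∂f/∂t = ½ f'' - γ f',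
solved for f''. -/
lemma hasDerivAt_maxPDFDeriv (ht : 0 < t) (m : ℝ) :
    HasDerivAt (maxPDFDeriv γ t) (2 * (maxPDFTime γ t m + γ * maxPDFDeriv γ t m)) m := by
  have hE := hasDerivAt_driftPDF γ t m
  have hW := hasDerivAt_reflTail (γ := γ) ht m
  have hl : HasDerivAt (fun m ↦ -(m - γ * t) / t) (-1 / t) m := by
    simpa using (((hasDerivAt_id m).sub_const (γ * t)).neg.div_const t)
  convert! ((hl.mul hE).const_mul 2).sub (((hW.const_mul (2 * γ)).sub hE).const_mul (2 * γ)) using 1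
  simp only [maxPDFTime, maxPDFDeriv]
  field_simp
  ring

lemma hasDerivAt_maxPDF_time (ht : 0 < t) (m : ℝ) :
    HasDerivAt (fun s ↦ maxPDF γ s m) (maxPDFTime γ t m) t := by
  have hsq : HasDerivAt (fun s ↦ √s) (1 / (2 * √t)) t := Real.hasDerivAt_sqrt ht.ne'
  have hst : √t ≠ 0 := (Real.sqrt_pos.2 ht).ne'
  have hz : HasDerivAt (fun s ↦ (m + γ * s) / √s)
      ((γ * √t - (m + γ * t) * (1 / (2 * √t))) / √t ^ 2) t := by
    have h : HasDerivAt (fun s ↦ m + γ * s) γ t := by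
      simpa using ((hasDerivAt_id t).const_mul γ).const_add m
    exact h.div hsq hst
  have hW : HasDerivAt (fun s ↦ reflTail γ s m) (driftPDF γ t m * ((m - γ * t) / (2 * t))) t := by
    convert! ((hasDerivAt_stdTail ((m + γ * t) / √t)).comp t hz).const_mul
      (Real.exp (2 * γ * m)) using 1
    rw [driftPDF_eq_exp_mul_stdPDF ht]
    have h2 : √t ^ 2 = t := Real.sq_sqrt ht.le
    field_simp
    rw [h2]
    ring
  have hE : HasDerivAt (fun s ↦ driftPDF γ s m)
      (driftPDF γ t m * (-1 / (2 * t) + γ * (m - γ * t) / t + (m - γ * t) ^ 2 / (2 * t ^ 2))) t := by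
    have h1 : HasDerivAt (fun s ↦ (√(2 * Real.pi * s))⁻¹)
        (-(2 * Real.pi / (2 * √(2 * Real.pi * t))) / √(2 * Real.pi * t) ^ 2) t := by
      have hp : 2 * Real.pi * t ≠ 0 := by positivity
      have h0 : HasDerivAt (fun s : ℝ ↦ 2 * Real.pi * s) (2 * Real.pi) t := by
        simpa using (hasDerivAt_id t).const_mul (2 * Real.pi)
      exact (h0.sqrt hp).inv (Real.sqrt_ne_zero'.2 (by positivity))
    have h2 : HasDerivAt (fun s ↦ -(m - γ * s) ^ 2 / (2 * s))
        (γ * (m - γ * t) / t + (m - γ * t) ^ 2 / (2 * t ^ 2)) t := by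
      have ha : HasDerivAt (fun s ↦ m - γ * s) (-γ) t := by
        simpa using ((hasDerivAt_id t).const_mul γ).const_sub m
      have hb : HasDerivAt (fun s : ℝ ↦ 2 * s) 2 t := by
        simpa using (hasDerivAt_id t).const_mul 2
      convert! (ha.pow 2).neg.div hb (by positivity) using 1
      simp
      field_simp
    convert! h1.mul h2.exp using 1
    rw [driftPDF, Real.sq_sqrt (by positivity)]
    have := Real.sqrt_pos.2 (show 0 < 2 * Real.pi * t by positivity)
    field_simp
    ring
  convert! (hE.const_mul 2).sub (hW.const_mul (2 * γ)) using 1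
  rw [maxPDFTime]
  field_simp
  ring

/-- Mills' inequality at z = (m + γt)/√t, which is at least γ√t. It lets every `reflTail` term be
controlled by the Gaussian density. -/
lemma mul_reflTail_le (ht : 0 < t) (hγ : 0 ≤ γ) {m : ℝ} (hm : 0 ≤ m) :
    γ * reflTail γ t m ≤ driftPDF γ t m := by
  have hst : 0 < √t := Real.sqrt_pos.2 ht
  have hz : γ * √t ≤ (m + γ * t) / √t := by
    rw [le_div_iff₀ hst, mul_assoc, Real.mul_self_sqrt ht.le]
    linarith
  have h1 : γ * √t * stdTail ((m + γ * t) / √t) ≤ stdPDF ((m + γ * t) / √t) :=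
    (mul_le_mul_of_nonneg_right hz (stdTail_nonneg _)).trans
      (mul_stdTail_le ((by positivity : 0 ≤ γ * √t).trans hz))
  rw [driftPDF_eq_exp_mul_stdPDF ht, reflTail, mul_div_assoc, mul_left_comm]
  refine mul_le_mul_of_nonneg_left ?_ (Real.exp_pos _).le
  rw [le_div_iff₀ hst]
  linarith

lemma maxPDF_nonneg (ht : 0 < t) (hγ : 0 ≤ γ) {m : ℝ} (hm : 0 ≤ m) : 0 ≤ maxPDF γ t m := by
  have := mul_reflTail_le ht hγ hm
  unfold maxPDF
  linarith

lemma maxPDF_le (hγ : 0 ≤ γ) (m : ℝ) : maxPDF γ t m ≤ 2 * driftPDF γ t m := by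
  have := mul_nonneg hγ (reflTail_nonneg γ t m)
  unfold maxPDF
  linarith

lemma maxTail_zero (γ t : ℝ) : maxTail γ t 0 = 1 := by
  have := stdTail_add_stdTail_neg (γ * t / √t)
  rw [maxTail, reflTail]
  simp only [zero_sub, zero_add, mul_zero, Real.exp_zero, one_mul, neg_div]
  linarith

/-- The zero-flux boundary condition of the forward equation. It removes p(0) from the boundary
terms of the integration by parts. -/
lemma maxPDFDeriv_zero (ht : 0 < t) : maxPDFDeriv γ t 0 = 2 * γ * maxPDF γ t 0 := by
  unfold maxPDFDeriv maxPDF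
  field_simp
  ring

/-- A majorant uniform for t in [a, b], for domination under the integral. The square is there
because the time derivative of the density carries a quadratic polynomial in m. -/
lemma sq_mul_driftPDF_le {a b : ℝ} (ha : 0 < a) (hta : a ≤ t) (htb : t ≤ b) (γ : ℝ) {m : ℝ}
    (hm : 0 ≤ m) :
    (1 + m) ^ 2 * driftPDF γ t m
      ≤ (√(2 * Real.pi * a))⁻¹ * Real.exp ((γ + 3) ^ 2 * b / 2) * Real.exp (-m) := by
  have ht : 0 < t := ha.trans_le hta
  have hb : 0 < b := ht.trans_le htb
  have h1 : (√(2 * Real.pi * t))⁻¹ ≤ (√(2 * Real.pi * a))⁻¹ := by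
    have : 0 < 2 * Real.pi * a := by positivity
    gcongr
  have h2 : (1 + m) ^ 2 ≤ Real.exp (2 * m) := by
    have := Real.add_one_le_exp m
    calc (1 + m) ^ 2 ≤ (Real.exp m) ^ 2 := by gcongr; linarith
      _ = _ := by rw [← Real.exp_nat_mul]; simp
  have h3 : 2 * m + -(m - γ * t) ^ 2 / (2 * t) ≤ (γ + 3) ^ 2 * b / 2 + -m := by
    have e1 : -(m - γ * t) ^ 2 / (2 * t) = -(m ^ 2 / (2 * t)) + γ * m - γ ^ 2 * t / 2 := by
      field_simp; ring
    have e2 : m ^ 2 / (2 * b) ≤ m ^ 2 / (2 * t) := by gcongr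
    -- The linear terms to absorb are γm from the drift, 2m from the polynomial factor and one more
    -- m to leave the decay exp(-m).
    have e3 : (γ + 3) * m ≤ m ^ 2 / (2 * b) + (γ + 3) ^ 2 * b / 2 := by
      have : m ^ 2 / (2 * b) + (γ + 3) ^ 2 * b / 2 - (γ + 3) * m
          = (m - (γ + 3) * b) ^ 2 / (2 * b) := by field_simp; ring
      have : 0 ≤ (m - (γ + 3) * b) ^ 2 / (2 * b) := by positivity
      linarith
    have e4 : 0 ≤ γ ^ 2 * t / 2 := by positivity
    rw [e1]
    linarith
  calc (1 + m) ^ 2 * driftPDF γ t m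
      ≤ Real.exp (2 * m) * ((√(2 * Real.pi * a))⁻¹ * Real.exp (-(m - γ * t) ^ 2 / (2 * t))) := by
        unfold driftPDF; gcongr
    _ = (√(2 * Real.pi * a))⁻¹ * Real.exp (2 * m + -(m - γ * t) ^ 2 / (2 * t)) := by
        rw [Real.exp_add]; ring
    _ ≤ (√(2 * Real.pi * a))⁻¹ * Real.exp ((γ + 3) ^ 2 * b / 2 + -m) := by gcongr
    _ = _ := by rw [Real.exp_add]; ring

lemma driftPDF_le_sq_mul (γ t : ℝ) {m : ℝ} (hm : 0 ≤ m) :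
    driftPDF γ t m ≤ (1 + m) ^ 2 * driftPDF γ t m :=
  le_mul_of_one_le_left (driftPDF_nonneg γ t m) (by nlinarith)

lemma continuous_driftPDF (γ t : ℝ) : Continuous (driftPDF γ t) :=
  continuous_iff_continuousAt.2 fun m ↦ (hasDerivAt_driftPDF γ t m).continuousAt

lemma continuous_maxPDF (ht : 0 < t) : Continuous (maxPDF γ t) :=
  continuous_iff_continuousAt.2 fun m ↦ (hasDerivAt_maxPDF ht m).continuousAt

lemma continuous_maxPDFTime (γ t : ℝ) : Continuous (maxPDFTime γ t) := by
  have := continuous_driftPDF γ t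
  unfold maxPDFTime
  fun_prop

lemma abs_maxPDFTime_le {a b : ℝ} (ha : 0 < a) (hta : a ≤ t) (htb : t ≤ b) (hγ : 0 ≤ γ) {m : ℝ}
    (hm : 0 ≤ m) :
    |maxPDFTime γ t m| ≤ ((1 / a + γ) ^ 2 + 1 / a + γ * (1 / a + γ)) *
      ((√(2 * Real.pi * a))⁻¹ * Real.exp ((γ + 3) ^ 2 * b / 2) * Real.exp (-m)) := by
  have ht : 0 < t := ha.trans_le hta
  have hinv : 1 / t ≤ 1 / a := one_div_le_one_div_of_le ha hta
  have h1 : |(m - γ * t) / t| ≤ (1 / a + γ) * (1 + m) := by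
    have : (m - γ * t) / t = m * (1 / t) - γ := by field_simp
    rw [this]
    have h0 : 0 ≤ 1 / t := by positivity
    have h3 : 0 ≤ m * (1 / t) := by positivity
    have h4 : m * (1 / t) ≤ m * (1 / a) := by gcongr
    have h5 : 0 ≤ γ * m := by positivity
    have h6 : 0 ≤ 1 / a := by positivity
    rw [abs_le]
    constructor <;> nlinarith
  have hA : 0 ≤ 1 / a + γ := by positivity
  have h2 : |((m - γ * t) / t) ^ 2 - 1 / t + γ * (m - γ * t) / t|
      ≤ ((1 / a + γ) ^ 2 + 1 / a + γ * (1 / a + γ)) * (1 + m) ^ 2 := by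
    have hm1 : (1 : ℝ) ≤ (1 + m) ^ 2 := by nlinarith
    have hm2 : 1 + m ≤ (1 + m) ^ 2 := by nlinarith
    calc |((m - γ * t) / t) ^ 2 - 1 / t + γ * (m - γ * t) / t|
        ≤ |((m - γ * t) / t) ^ 2| + |1 / t| + |γ * ((m - γ * t) / t)| := by
          rw [mul_div_assoc]
          exact (abs_add_le _ _).trans (by gcongr; exact abs_sub _ _)
      _ = |(m - γ * t) / t| ^ 2 + 1 / t + γ * |(m - γ * t) / t| := by
          rw [abs_pow, abs_mul, abs_of_nonneg hγ, abs_of_nonneg (by positivity : 0 ≤ 1 / t)]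
      _ ≤ ((1 / a + γ) * (1 + m)) ^ 2 + 1 / a * 1 + γ * ((1 / a + γ) * (1 + m)) := by
          rw [mul_one]; gcongr
      _ ≤ ((1 / a + γ) * (1 + m)) ^ 2 + 1 / a * (1 + m) ^ 2
          + γ * ((1 / a + γ) * (1 + m) ^ 2) := by gcongr
      _ = _ := by ring
  have hC : 0 ≤ (1 / a + γ) ^ 2 + 1 / a + γ * (1 / a + γ) := by positivity
  calc |maxPDFTime γ t m|
      = driftPDF γ t m * |((m - γ * t) / t) ^ 2 - 1 / t + γ * (m - γ * t) / t| := by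
        rw [maxPDFTime, abs_mul, abs_of_nonneg (driftPDF_nonneg _ _ _)]
    _ ≤ driftPDF γ t m * (((1 / a + γ) ^ 2 + 1 / a + γ * (1 / a + γ)) * (1 + m) ^ 2) :=
        mul_le_mul_of_nonneg_left h2 (driftPDF_nonneg _ _ _)
    _ = ((1 / a + γ) ^ 2 + 1 / a + γ * (1 / a + γ)) * ((1 + m) ^ 2 * driftPDF γ t m) := by ring
    _ ≤ _ := mul_le_mul_of_nonneg_left (sq_mul_driftPDF_le ha hta htb γ hm) hC

lemma tendsto_sq_mul_driftPDF (ht : 0 < t) :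
    Tendsto (fun m ↦ (1 + m) ^ 2 * driftPDF γ t m) atTop (𝓝 0) := by
  have h : Tendsto (fun m : ℝ ↦ (√(2 * Real.pi * t))⁻¹ * Real.exp ((γ + 3) ^ 2 * t / 2) *
      Real.exp (-m)) atTop (𝓝 0) := by
    simpa using Real.tendsto_exp_neg_atTop_nhds_zero.const_mul
      ((√(2 * Real.pi * t))⁻¹ * Real.exp ((γ + 3) ^ 2 * t / 2))
  refine squeeze_zero' ?_ ?_ h
  · exact Eventually.of_forall fun m ↦ mul_nonneg (sq_nonneg _) (driftPDF_nonneg _ _ _)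
  · filter_upwards [eventually_ge_atTop 0] with m hm
    exact sq_mul_driftPDF_le ht le_rfl le_rfl γ hm

lemma tendsto_maxPDF (ht : 0 < t) (hγ : 0 ≤ γ) : Tendsto (maxPDF γ t) atTop (𝓝 0) := by
  have h := (tendsto_sq_mul_driftPDF (γ := γ) ht).const_mul 2
  rw [mul_zero] at h
  refine squeeze_zero' ?_ ?_ h
  · filter_upwards [eventually_ge_atTop 0] with m hm using maxPDF_nonneg ht hγ hm
  · filter_upwards [eventually_ge_atTop 0] with m hm
    have h1 := maxPDF_le (t := t) hγ m
    have h2 := driftPDF_le_sq_mul γ t hm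
    linarith

lemma tendsto_maxPDFDeriv (ht : 0 < t) (hγ : 0 ≤ γ) :
    Tendsto (maxPDFDeriv γ t) atTop (𝓝 0) := by
  have h := (tendsto_sq_mul_driftPDF (γ := γ) ht).const_mul (2 * (1 / t + γ) + 2 * γ)
  rw [mul_zero] at h
  refine squeeze_zero_norm' ?_ h
  filter_upwards [eventually_ge_atTop 0] with m hm
  have h1 := mul_reflTail_le ht hγ hm
  have h2 := driftPDF_nonneg γ t m
  have h3 := mul_nonneg hγ (reflTail_nonneg γ t m)
  have hi : 0 ≤ 1 / t := by positivity
  have e : -(m - γ * t) / t = γ - m * (1 / t) := by field_simp; ring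
  have h4 : |2 * γ * reflTail γ t m - driftPDF γ t m| ≤ driftPDF γ t m := by
    rw [abs_le]; constructor <;> linarith
  have h5 : |-(m - γ * t) / t| ≤ (1 / t + γ) * (1 + m) := by
    have := mul_nonneg hm hi
    have := mul_nonneg hγ hm
    rw [e, abs_le]
    constructor <;> linarith
  have hm2 : 1 + m ≤ (1 + m) ^ 2 := by nlinarith
  have hm1 : (1 : ℝ) ≤ (1 + m) ^ 2 := by nlinarith
  rw [Real.norm_eq_abs]
  calc |maxPDFDeriv γ t m|
      ≤ 2 * (|-(m - γ * t) / t| * driftPDF γ t m)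
        + 2 * γ * |2 * γ * reflTail γ t m - driftPDF γ t m| := by
        unfold maxPDFDeriv
        refine (abs_sub _ _).trans_eq ?_
        simp only [abs_mul, abs_of_nonneg h2, abs_of_nonneg hγ, abs_two]
    _ ≤ 2 * ((1 / t + γ) * (1 + m) * driftPDF γ t m) + 2 * γ * (1 * driftPDF γ t m) := by
        rw [one_mul]; gcongr
    _ ≤ 2 * ((1 / t + γ) * (1 + m) ^ 2 * driftPDF γ t m)
        + 2 * γ * ((1 + m) ^ 2 * driftPDF γ t m) := by gcongr
    _ = _ := by ring

lemma integrableOn_maxPDF (ht : 0 < t) (hγ : 0 ≤ γ) : IntegrableOn (maxPDF γ t) (Ioi 0) := by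
  have hb : IntegrableOn (fun m : ℝ ↦ 2 * ((√(2 * Real.pi * t))⁻¹ *
      Real.exp ((γ + 3) ^ 2 * t / 2) * Real.exp (-m))) (Ioi 0) :=
    ((integrableOn_exp_neg_Ioi 0).const_mul _).const_mul 2
  refine Integrable.mono' hb (continuous_maxPDF ht).aestronglyMeasurable ?_
  filter_upwards [ae_restrict_mem measurableSet_Ioi] with m hm
  have hm : 0 ≤ m := le_of_lt hm
  rw [Real.norm_of_nonneg (maxPDF_nonneg ht hγ hm)]
  have h1 := maxPDF_le (t := t) hγ m
  have h2 := driftPDF_le_sq_mul γ t hm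
  have h3 := sq_mul_driftPDF_le ht le_rfl le_rfl γ hm
  linarith

/-- The time derivative of the mean of a function of the running maximum. -/
theorem hasDerivAt_integral_mul_maxPDF (ht : 0 < t) (hγ : 0 ≤ γ) {p p' p'' : ℝ → ℝ} {K : ℝ}
    (hp : ∀ x, HasDerivAt p (p' x) x) (hp' : ∀ x, HasDerivAt p' (p'' x) x)
    (hcont : Continuous p'') (hK : ∀ x, 0 ≤ x → |p x| ≤ K) (hK' : ∀ x, 0 ≤ x → |p' x| ≤ K)
    (hK'' : ∀ x, 0 ≤ x → |p'' x| ≤ K) :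
    HasDerivAt (fun s ↦ ∫ m in Ioi 0, p m * maxPDF γ s m)
      ((∫ m in Ioi 0, (1 / 2 * p'' m + γ * p' m) * maxPDF γ t m)
        + 1 / 2 * maxPDF γ t 0 * p' 0) t := by
  have hpc : Continuous p := continuous_iff_continuousAt.2 fun x ↦ (hp x).continuousAt
  have hpc' : Continuous p' := continuous_iff_continuousAt.2 fun x ↦ (hp' x).continuousAt
  have hK0 : 0 ≤ K := (abs_nonneg _).trans (hK 0 le_rfl)
  have hmem : ∀ᵐ m ∂(volume.restrict (Ioi (0 : ℝ))), 0 ≤ m := by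
    filter_upwards [ae_restrict_mem measurableSet_Ioi] with m hm using le_of_lt hm
  have hint {r : ℝ → ℝ} {L : ℝ} (hr : Continuous r) (hL : ∀ x, 0 ≤ x → |r x| ≤ L) :
      IntegrableOn (fun m ↦ r m * maxPDF γ t m) (Ioi 0) := by
    refine Integrable.bdd_mul (c := L) (integrableOn_maxPDF ht hγ) hr.aestronglyMeasurable ?_
    filter_upwards [hmem] with m hm using hL m hm
  -- Differentiation under the integral, dominated for s in [t/2, 2t], away from the singularity at
  -- s = 0.
  obtain ⟨hI, hD⟩ := hasDerivAt_integral_of_dominated_loc_of_deriv_le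
    (μ := volume.restrict (Ioi (0 : ℝ))) (F := fun s m ↦ p m * maxPDF γ s m) (x₀ := t)
    (F' := fun s m ↦ p m * maxPDFTime γ s m)
    (bound := fun m ↦ K * (((1 / (t / 2) + γ) ^ 2 + 1 / (t / 2) + γ * (1 / (t / 2) + γ)) *
      ((√(2 * Real.pi * (t / 2)))⁻¹ * Real.exp ((γ + 3) ^ 2 * (2 * t) / 2) * Real.exp (-m))))
    (Icc_mem_nhds (show t / 2 < t by linarith) (show t < 2 * t by linarith))
    (by
      filter_upwards [Ioi_mem_nhds ht] with s hs
      exact (hpc.mul (continuous_maxPDF hs)).aestronglyMeasurable)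
    (hint hpc hK) (hpc.mul (continuous_maxPDFTime γ t)).aestronglyMeasurable
    (by
      filter_upwards [hmem] with m hm s hs
      rw [norm_mul, Real.norm_eq_abs, Real.norm_eq_abs]
      exact mul_le_mul (hK m hm) (abs_maxPDFTime_le (by positivity) hs.1 hs.2 hγ hm)
        (abs_nonneg _) hK0)
    ((((integrableOn_exp_neg_Ioi 0).const_mul _).const_mul _).const_mul _)
    (by
      filter_upwards with m s hs
      exact (hasDerivAt_maxPDF_time (by linarith [hs.1]) m).const_mul (p m))
  convert! hD using 1
  have hJ := hint (r := fun m ↦ 1 / 2 * p'' m + γ * p' m) (L := 1 / 2 * K + γ * K)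
    (by fun_prop) fun x hx ↦ by
      refine (abs_add_le _ _).trans ?_
      rw [abs_mul, abs_mul, abs_of_nonneg hγ, abs_of_pos (by norm_num : (0 : ℝ) < 1 / 2)]
      have := hK' x hx
      have := hK'' x hx
      gcongr
  -- By the forward equation, p ∂f/∂t - (½ p'' + γ p') f is an exact derivative in m.
  have hder (m : ℝ) : HasDerivAt
      (fun m ↦ 1 / 2 * (p m * maxPDFDeriv γ t m - p' m * maxPDF γ t m)
        - γ * (p m * maxPDF γ t m))
      (p m * maxPDFTime γ t m - (1 / 2 * p'' m + γ * p' m) * maxPDF γ t m) m := by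
    have h0 := hasDerivAt_maxPDF (γ := γ) ht m
    have h1 := hasDerivAt_maxPDFDeriv (γ := γ) ht m
    convert! ((((hp m).mul h1).sub ((hp' m).mul h0)).const_mul (1 / 2)).sub
      (((hp m).mul h0).const_mul γ) using 1
    ring
  have hbdd {r u : ℝ → ℝ} (hr : ∀ x, 0 ≤ x → |r x| ≤ K) (hu : Tendsto u atTop (𝓝 0)) :
      Tendsto (fun m ↦ r m * u m) atTop (𝓝 0) := by
    have h := (hu.norm).const_mul K
    rw [norm_zero, mul_zero] at h
    refine squeeze_zero_norm' ?_ h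
    filter_upwards [eventually_ge_atTop 0] with m hm
    rw [norm_mul]
    exact mul_le_mul_of_nonneg_right (hr m hm) (norm_nonneg _)
  have hlim : Tendsto (fun m ↦ 1 / 2 * (p m * maxPDFDeriv γ t m - p' m * maxPDF γ t m)
        - γ * (p m * maxPDF γ t m)) atTop (𝓝 0) := by
    simpa only [sub_zero, mul_zero] using (((hbdd hK (tendsto_maxPDFDeriv ht hγ)).sub
      (hbdd hK' (tendsto_maxPDF ht hγ))).const_mul (1 / 2)).sub
      ((hbdd hK (tendsto_maxPDF ht hγ)).const_mul γ)
  have hFTC := integral_Ioi_of_hasDerivAt_of_tendsto' (a := 0) (fun m _ ↦ hder m)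
    (hI.sub hJ) hlim
  -- At m = 0 the primitive is ½(p f' - p' f) - γ p f, which the zero-flux condition reduces to -½
  -- p'(0) f(t, 0).
  rw [integral_sub hI hJ, maxPDFDeriv_zero ht] at hFTC
  linarith

end Density

/-! ### First crossings of a level along a grid -/

/-- The grid of mesh `t / (n + 1)`. -/
def grid (t : ℝ≥0) (n j : ℕ) : ℝ≥0 := t * (j / (n + 1))

/-- The path `x` exceeds the level `m` on the grid at the index `j` for the first time. -/
def FirstCross (x : ℝ≥0 → ℝ) (m : ℝ) (t : ℝ≥0) (n j : ℕ) : Prop :=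
  (∀ i < j, x (grid t n i) ≤ m) ∧ m < x (grid t n j)

open Classical in
/-- The value of `ψ` at the first point of the grid at which the path exceeds the level `m`. -/
def crossValue (x : ℝ≥0 → ℝ) (m : ℝ) (t : ℝ≥0) (n : ℕ) (ψ : ℝ → ENNReal) : ENNReal :=
  ∑ j ∈ Finset.range (n + 2), if FirstCross x m t n j then ψ (x (grid t n j)) else 0

lemma grid_zero (t : ℝ≥0) (n : ℕ) : grid t n 0 = 0 := by simp [grid]

lemma grid_mono (t : ℝ≥0) (n : ℕ) : Monotone (grid t n) := fun i j hij ↦ by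
  unfold grid
  gcongr

lemma grid_last (t : ℝ≥0) (n : ℕ) : grid t n (n + 1) = t := by
  have : ((n : ℝ≥0) + 1) ≠ 0 := by positivity
  simp [grid, this]

lemma grid_le (t : ℝ≥0) {n j : ℕ} (hj : j < n + 2) : grid t n j ≤ t :=
  (grid_mono t n (Nat.lt_succ_iff.1 hj)).trans_eq (grid_last t n)

lemma grid_succ (t : ℝ≥0) (n j : ℕ) : grid t n (j + 1) = grid t n j + t / (n + 1) := by
  unfold grid
  push_cast
  ring

lemma FirstCross.unique {x : ℝ≥0 → ℝ} {m : ℝ} {t : ℝ≥0} {n i j : ℕ} (hi : FirstCross x m t n i)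
    (hj : FirstCross x m t n j) : i = j := by
  rcases lt_trichotomy i j with h | h | h
  · exact absurd (hj.1 i h) (not_le.2 hi.2)
  · exact h
  · exact absurd (hi.1 j h) (not_le.2 hj.2)

lemma crossValue_of_firstCross {x : ℝ≥0 → ℝ} {m : ℝ} {t : ℝ≥0} {n j : ℕ} (ψ : ℝ → ENNReal)
    (hj : j < n + 2) (h : FirstCross x m t n j) :
    crossValue x m t n ψ = ψ (x (grid t n j)) := by
  unfold crossValue
  rw [Finset.sum_eq_single j, if_pos h]
  · intro i _ hij
    exact if_neg fun hi ↦ hij (hi.unique h)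
  · intro hj'
    exact absurd (Finset.mem_range.2 hj) hj'

lemma crossValue_of_forall_le {x : ℝ≥0 → ℝ} {m : ℝ} {t : ℝ≥0} {n : ℕ} (ψ : ℝ → ENNReal)
    (h : ∀ j < n + 2, x (grid t n j) ≤ m) : crossValue x m t n ψ = 0 :=
  Finset.sum_eq_zero fun j hj ↦ if_neg fun hc ↦
    absurd (h j (Finset.mem_range.1 hj)) (not_le.2 hc.2)

lemma exists_firstCross {x : ℝ≥0 → ℝ} {m : ℝ} {t : ℝ≥0} {n i : ℕ} (hi : i < n + 2)
    (h : m < x (grid t n i)) : ∃ j < n + 2, FirstCross x m t n j := by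
  classical
  have hex : ∃ i, m < x (grid t n i) := ⟨i, h⟩
  exact ⟨Nat.find hex, (Nat.find_min' hex h).trans_lt hi,
    fun k hk ↦ not_lt.1 (Nat.find_min hex hk), Nat.find_spec hex⟩

lemma crossValue_cases (x : ℝ≥0 → ℝ) (m : ℝ) (t : ℝ≥0) (n : ℕ) (ψ : ℝ → ENNReal) :
    (∃ a, m < a ∧ crossValue x m t n ψ = ψ a) ∨ crossValue x m t n ψ = 0 := by
  by_cases h : ∃ i < n + 2, m < x (grid t n i)
  · obtain ⟨i, hi, hx⟩ := h
    obtain ⟨j, hj, hc⟩ := exists_firstCross hi hx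
    exact .inl ⟨_, hc.2, crossValue_of_firstCross ψ hj hc⟩
  · push Not at h
    exact .inr (crossValue_of_forall_le ψ h)

/-- The grid point before the first crossing lies at or below the level, so by uniform continuity
the overshoot tends to 0 with the mesh. -/
lemma tendsto_crossValue {x : ℝ≥0 → ℝ} (hx : Continuous x) {m : ℝ} (h0 : x 0 ≤ m) {t s : ℝ≥0}
    (hst : s ≤ t) (hs : m < x s) {ψ : ℝ → ENNReal} (hψ : ContinuousAt ψ m) :
    Tendsto (fun n ↦ crossValue x m t n ψ) atTop (𝓝 (ψ m)) := by
  intro U hU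
  obtain ⟨ε₀, hε₀, hball⟩ := Metric.mem_nhds_iff.1 (hψ hU)
  -- The bound x s - m keeps the grid point just after s above the level, so a crossing exists; the
  -- bound ε₀ controls the overshoot.
  set ε := min ε₀ (x s - m) with hε
  have hεpos : 0 < ε := lt_min hε₀ (sub_pos.2 hs)
  obtain ⟨η, hη, hunif⟩ := Metric.uniformContinuousOn_iff.1
    (isCompact_Icc.uniformContinuousOn_of_continuous (hx.continuousOn (s := Icc 0 t))) ε hεpos
  have hmesh : ∀ᶠ n : ℕ in atTop, (t : ℝ) / (n + 1) < η :=
    (tendsto_order.1 (tendsto_const_div_atTop_nhds_zero_nat (t : ℝ) |>.comp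
      (tendsto_add_atTop_nat 1))).2 η hη |>.mono fun n hn ↦ by simpa using hn
  refine mem_map.2 ?_
  filter_upwards [hmesh] with n hn
  have hclose {a b : ℝ≥0} (hab : a ≤ b) (hba : (b : ℝ) ≤ a + t / (n + 1)) (hb : b ≤ t) :
      dist (x b) (x a) < ε := by
    refine hunif b ⟨zero_le, hb⟩ a ⟨zero_le, hab.trans hb⟩ ?_
    rw [NNReal.dist_eq, abs_of_nonneg (sub_nonneg.2 (NNReal.coe_le_coe.2 hab))]
    linarith
  -- the grid meets the set where the path exceeds the level
  have hhit : ∃ i < n + 2, m < x (grid t n i) := by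
    classical
    have hex : ∃ i, s ≤ grid t n i := ⟨n + 1, by rwa [grid_last]⟩
    have hle : Nat.find hex ≤ n + 1 := Nat.find_min' hex (by rwa [grid_last])
    refine ⟨Nat.find hex, by omega, ?_⟩
    have hspec := Nat.find_spec hex
    have hd : dist (x (grid t n (Nat.find hex))) (x s) < ε := by
      refine hclose hspec ?_ (grid_le t (by omega))
      rcases hk : Nat.find hex with _ | k
      · rw [grid_zero]
        have : (0 : ℝ) ≤ t / (n + 1) := by positivity
        have := s.coe_nonneg
        simp only [NNReal.coe_zero]
        linarith
      · have hlt : grid t n k < s := not_le.1 (Nat.find_min hex (by omega))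
        rw [grid_succ]
        push_cast
        have := NNReal.coe_lt_coe.2 hlt
        linarith
    have h2 : ε ≤ x s - m := min_le_right _ _
    rw [Real.dist_eq, abs_lt] at hd
    linarith [hd.1]
  obtain ⟨i, hi, hxi⟩ := hhit
  obtain ⟨j, hj, hc⟩ := exists_firstCross hi hxi
  rw [mem_preimage, crossValue_of_firstCross ψ hj hc]
  refine hball ?_
  rcases j with _ | k
  -- A crossing at index 0 would contradict x 0 ≤ m, so there is a preceding grid point.
  · exact absurd h0 (not_le.2 (by simpa [grid_zero] using hc.2))
  · have hk : x (grid t n k) ≤ m := hc.1 k (Nat.lt_succ_self k)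
    have hd : dist (x (grid t n (k + 1))) (x (grid t n k)) < ε := by
      refine hclose (grid_mono t n (Nat.le_succ k)) ?_ (grid_le t hj)
      rw [grid_succ]
      push_cast
      exact le_rfl
    have h1 : ε ≤ ε₀ := min_le_left _ _
    rw [Real.dist_eq, abs_lt] at hd
    rw [Metric.mem_ball, Real.dist_eq, abs_lt]
    have := hc.2
    constructor <;> linarith [hd.2]

/-! ### The reflection principle for a Brownian motion with drift -/

/-- The two exponents differ by (x + γr)² - (x - γr)² = 4γrx over 2r. The exponential is the price
of reflecting an increment with drift. -/
lemma gaussianPDF_neg (γ : ℝ) {r : ℝ≥0} (hr : r ≠ 0) (x : ℝ) :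
    gaussianPDF (γ * r) r (-x)
      = gaussianPDF (γ * r) r x * ENNReal.ofReal (Real.exp (-2 * γ * x)) := by
  have hr' : (r : ℝ) ≠ 0 := by exact_mod_cast hr
  rw [gaussianPDF, gaussianPDF, ← ENNReal.ofReal_mul (gaussianPDFReal_nonneg _ _ _),
    gaussianPDFReal, gaussianPDFReal, mul_assoc (√_)⁻¹, ← Real.exp_add]
  congr 3
  field_simp
  ring

lemma lintegral_gaussianReal_neg (γ : ℝ) (r : ℝ≥0) {F : ℝ → ENNReal} (hF : Measurable F) :
    ∫⁻ x, F x ∂(gaussianReal (γ * r) r)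
      = ∫⁻ x, F (-x) * ENNReal.ofReal (Real.exp (-2 * γ * x)) ∂(gaussianReal (γ * r) r) := by
  -- The degenerate variance occurs when the first crossing is at the last grid point, which is the
  -- final time.
  rcases eq_or_ne r 0 with rfl | hr
  · simp
  · rw [gaussianReal_of_var_ne_zero _ hr,
      lintegral_withDensity_eq_lintegral_mul _ (measurable_gaussianPDF _ _) hF,
      lintegral_withDensity_eq_lintegral_mul _ (measurable_gaussianPDF _ _) (by fun_prop),
      ← lintegral_neg_eq_self]
    refine lintegral_congr fun x ↦ ?_
    simp only [Pi.mul_apply]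
    rw [gaussianPDF_neg γ hr]
    ring

variable {Ω : Type*} [MeasurableSpace Ω] {P : Measure Ω}

/-- Reflection of a Gaussian increment that is independent of the past. -/
lemma lintegral_reflect [IsProbabilityMeasure P] {S : Type*} [MeasurableSpace S] {Y : Ω → S} {D : Ω → ℝ}
    (hY : AEMeasurable Y P) {γ : ℝ} {r : ℝ≥0} (hD : HasLaw D (gaussianReal (γ * r) r) P)
    (hind : IndepFun Y D P) {F : S × ℝ → ENNReal} (hF : Measurable F) :
    ∫⁻ ω, F (Y ω, D ω) ∂P
      = ∫⁻ ω, F (Y ω, -D ω) * ENNReal.ofReal (Real.exp (-2 * γ * D ω)) ∂P := by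
  have hmap := (indepFun_iff_map_prod_eq_prod_map_map hY hD.aemeasurable).1 hind
  have hG : Measurable fun p : S × ℝ ↦
      F (p.1, -p.2) * ENNReal.ofReal (Real.exp (-2 * γ * p.2)) := by fun_prop
  have hYD : AEMeasurable (fun ω ↦ (Y ω, D ω)) P := hY.prodMk hD.aemeasurable
  have hprob : IsProbabilityMeasure (P.map Y) := Measure.isProbabilityMeasure_map hY
  rw [← lintegral_map' (f := F) hF.aemeasurable hYD,
    ← lintegral_map' (f := fun p : S × ℝ ↦
      F (p.1, -p.2) * ENNReal.ofReal (Real.exp (-2 * γ * p.2))) hG.aemeasurable hYD, hmap,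
    hD.map_eq, lintegral_prod _ hF.aemeasurable, lintegral_prod _ hG.aemeasurable]
  exact lintegral_congr fun y ↦ lintegral_gaussianReal_neg γ r (F := fun d ↦ F (y, d)) (by fun_prop)

/-- The Brownian motion with drift. -/
def drifted (B : ℝ≥0 → Ω → ℝ) (γ : ℝ) (s : ℝ≥0) (ω : Ω) : ℝ := B s ω + γ * s

variable {B : ℝ≥0 → Ω → ℝ}

lemma aemeasurable_drifted (hB : IsPreBrownianReal B P) (γ : ℝ) (s : ℝ≥0) :
    AEMeasurable (drifted B γ s) P := (hB.aemeasurable s).add_const _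

lemma hasLaw_drifted_sub (hB : IsPreBrownianReal B P) (γ : ℝ) {s t : ℝ≥0} (hst : s ≤ t) :
    HasLaw (fun ω ↦ drifted B γ t ω - drifted B γ s ω)
      (gaussianReal (γ * (t - s : ℝ≥0)) (t - s)) P := by
  have h := hB.hasLaw_sub t s
  have hn : nndist (t : ℝ) (s : ℝ) = t - s := by
    ext
    rw [coe_nndist, Real.dist_eq, NNReal.coe_sub hst, abs_of_nonneg]
    exact sub_nonneg.2 (NNReal.coe_le_coe.2 hst)
  have h2 := gaussianReal_add_const h (γ * (t - s : ℝ≥0))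
  have hn' : nndist t.1 s.1 = t - s := hn
  rw [hn', zero_add] at h2
  refine h2.congr (Eventually.of_forall fun ω ↦ ?_)
  simp only [drifted, Pi.sub_apply]
  rw [NNReal.coe_sub hst]
  ring

lemma hasLaw_drifted (hB : IsPreBrownianReal B P) (γ : ℝ) (t : ℝ≥0) :
    HasLaw (drifted B γ t) (gaussianReal (γ * t) t) P := by
  have h := gaussianReal_add_const (hB.hasLaw_eval t) (γ * t)
  rw [zero_add] at h
  exact h

/-- The weight of a path that is reflected at the value `a` and ends at `b`. -/
def reflWeight (γ m b a : ℝ) : ENNReal :=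
  (Iio m).indicator (fun _ ↦ ENNReal.ofReal (Real.exp (-2 * γ * (b - a)))) (2 * a - b)

-- The crossing event depends on the path up to the crossing time only, and the increment from there
-- to t is independent of it. Reflecting that increment at the crossing value a exchanges the
-- endpoints b and 2a - b.
open Classical in
lemma lintegral_firstCross_reflect [IsProbabilityMeasure P] (hB : IsPreBrownianReal B P) (γ m : ℝ)
    (t : ℝ≥0) {n j : ℕ} (hj : j < n + 2) :
    ∫⁻ ω, (if FirstCross (drifted B γ · ω) m t n j then
        (Iio m).indicator 1 (drifted B γ t ω) else 0) ∂P
      = ∫⁻ ω, (if FirstCross (drifted B γ · ω) m t n j then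
        reflWeight γ m (drifted B γ t ω) (drifted B γ (grid t n j) ω) else 0) ∂P := by
  set u := grid t n j with hu
  have hut : u ≤ t := grid_le t hj
  -- The grid values frozen at index j form a countable record of the past of u, hence independent
  -- of D.
  let Y : Ω → ℕ → ℝ := fun ω i ↦ drifted B γ (grid t n (min i j)) ω
  let D : Ω → ℝ := fun ω ↦ drifted B γ t ω - drifted B γ u ω
  have hY : AEMeasurable Y P := aemeasurable_pi_lambda _ fun i ↦ aemeasurable_drifted hB γ _
  have hind : IndepFun Y D P := by
    have hle (i : ℕ) : grid t n (min i j) ≤ u := grid_mono t n (min_le_right i j)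
    have h := (hB.indepFun_shift u).symm.comp
      (φ := fun (v : Iic u → ℝ) (i : ℕ) ↦ v ⟨grid t n (min i j), hle i⟩ + γ * grid t n (min i j))
      (ψ := fun v : ℝ≥0 → ℝ ↦ v (t - u) + γ * (t - u)) (by fun_prop) (by fun_prop)
    convert! h using 1
    ext ω
    simp only [D, drifted, Function.comp_apply]
    rw [add_tsub_cancel_of_le hut]
    ring
  let A : Set ((ℕ → ℝ) × ℝ) := {p | (∀ i < j, p.1 i ≤ m) ∧ m < p.1 j ∧ p.1 j + p.2 < m}
  have hA : MeasurableSet A := by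
    have h1 : MeasurableSet {p : (ℕ → ℝ) × ℝ | m < p.1 j} :=
      measurableSet_lt (by fun_prop) (by fun_prop)
    have h2 : MeasurableSet {p : (ℕ → ℝ) × ℝ | p.1 j + p.2 < m} :=
      measurableSet_lt (by fun_prop) (by fun_prop)
    refine MeasurableSet.inter ?_ (h1.inter h2)
    have : {p : (ℕ → ℝ) × ℝ | ∀ i < j, p.1 i ≤ m} = ⋂ i, ⋂ (_ : i < j), {p | p.1 i ≤ m} := by
      ext; simp
    change MeasurableSet {p : (ℕ → ℝ) × ℝ | ∀ i < j, p.1 i ≤ m}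
    rw [this]
    exact .iInter fun i ↦ .iInter fun _ ↦ measurableSet_le (by fun_prop) (by fun_prop)
  have h := lintegral_reflect hY (hasLaw_drifted_sub hB γ hut) hind
    (F := A.indicator 1) (measurable_one.indicator hA)
  have hYi (ω : Ω) : (∀ i < j, Y ω i ≤ m) ↔ ∀ i < j, drifted B γ (grid t n i) ω ≤ m := by
    refine forall₂_congr fun i hi ↦ ?_
    simp only [Y, min_eq_left hi.le]
  have hYj (ω : Ω) : Y ω j = drifted B γ u ω := by simp [Y, hu]
  convert h using 1
  · refine lintegral_congr fun ω ↦ ?_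
    have : ((Y ω, drifted B γ t ω - drifted B γ u ω) ∈ A) ↔
        FirstCross (drifted B γ · ω) m t n j ∧ drifted B γ t ω < m := by
      simp only [A, mem_ofPred_eq, hYi, hYj, FirstCross, add_sub_cancel, and_assoc]
      exact Iff.rfl
    simp only [indicator_apply, this, mem_Iio, Pi.one_apply, ite_and]
  · refine lintegral_congr fun ω ↦ ?_
    have : ((Y ω, -(drifted B γ t ω - drifted B γ u ω)) ∈ A) ↔
        FirstCross (drifted B γ · ω) m t n j ∧ 2 * drifted B γ u ω - drifted B γ t ω < m := by
      simp only [A, mem_ofPred_eq, hYi, hYj, FirstCross, and_assoc]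
      rw [show drifted B γ u ω + -(drifted B γ t ω - drifted B γ u ω)
        = 2 * drifted B γ u ω - drifted B γ t ω by ring]
    simp only [indicator_apply, this, mem_Iio, Pi.one_apply, ite_and, reflWeight, ite_mul, one_mul,
      zero_mul]

/-- If 2a - b < m < a then b > a, so the exponent is nonpositive for γ ≥ 0. This supplies the
constant majorant for the limit of vanishing mesh. -/
lemma reflWeight_le_one {γ : ℝ} (hγ : 0 ≤ γ) {m a : ℝ} (b : ℝ) (ha : m < a) :
    reflWeight γ m b a ≤ 1 := by
  unfold reflWeight
  rw [indicator_apply]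
  split_ifs with h
  · rw [ENNReal.ofReal_le_one, Real.exp_le_one_iff]
    have h : 2 * a - b < m := h
    have : 0 ≤ γ * (b - a) := mul_nonneg hγ (by linarith)
    linarith
  · exact zero_le_one

lemma measurable_reflWeight (γ m : ℝ) : Measurable fun p : ℝ × ℝ ↦ reflWeight γ m p.1 p.2 := by
  have h1 : Measurable fun p : ℝ × ℝ ↦ ENNReal.ofReal (Real.exp (-2 * γ * (p.1 - p.2))) := by
    fun_prop
  have h2 : MeasurableSet {p : ℝ × ℝ | 2 * p.2 - p.1 < m} :=
    measurableSet_lt (by fun_prop) (by fun_prop)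
  convert! h1.indicator h2 using 1

/-- The reflection value a decreases to m in the limit. If the path ends below m, then 2a - b > m
for every a > m and the weight vanishes; if it ends above m, the weight is continuous at a = m. The
excluded case `x t = m` is the discontinuity. -/
lemma tendsto_crossValue_reflWeight {x : ℝ≥0 → ℝ} (hx : Continuous x) (γ : ℝ) {m : ℝ}
    (h0 : x 0 ≤ m) {t : ℝ≥0} (ht : x t ≠ m) :
    Tendsto (fun n ↦ crossValue x m t n (reflWeight γ m (x t))) atTop
      (𝓝 ((Ioi m).indicator (fun b ↦ ENNReal.ofReal (Real.exp (-2 * γ * (b - m)))) (x t))) := by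
  rcases ht.lt_or_gt with h | h
  · rw [indicator_of_notMem (by simpa using h.le)]
    refine tendsto_const_nhds.congr fun n ↦ ?_
    rcases crossValue_cases x m t n (reflWeight γ m (x t)) with ⟨a, ha, hv⟩ | hv
    · rw [hv, reflWeight, indicator_of_notMem]
      simp only [mem_Iio, not_lt]
      linarith
    · exact hv.symm
  · rw [indicator_of_mem (show x t ∈ Ioi m from h)]
    have hev : reflWeight γ m (x t)
        =ᶠ[𝓝 m] fun a ↦ ENNReal.ofReal (Real.exp (-2 * γ * (x t - a))) := by
      have : ∀ᶠ a in 𝓝 m, 2 * a - x t < m := by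
        have hc : Continuous fun a : ℝ ↦ 2 * a - x t := by fun_prop
        exact hc.continuousAt.eventually_lt continuousAt_const (by linarith)
      filter_upwards [this] with a ha
      rw [reflWeight, indicator_of_mem (show 2 * a - x t ∈ Iio m from ha)]
    have hc : ContinuousAt (reflWeight γ m (x t)) m := by
      refine ContinuousAt.congr ?_ hev.symm
      exact (ENNReal.continuous_ofReal.comp (by fun_prop)).continuousAt
    have := tendsto_crossValue hx h0 le_rfl h hc
    rwa [hev.eq_of_nhds] at this

lemma tendsto_crossValue_indicator {x : ℝ≥0 → ℝ} (hx : Continuous x) {m : ℝ} (h0 : x 0 ≤ m)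
    {t : ℝ≥0} (c : ENNReal) :
    Tendsto (fun n ↦ crossValue x m t n (fun _ ↦ c)) atTop
      (𝓝 ({y : ℝ≥0 → ℝ | ∃ s ≤ t, m < y s}.indicator (fun _ ↦ c) x)) := by
  by_cases h : ∃ s ≤ t, m < x s
  · rw [indicator_of_mem (show x ∈ {y : ℝ≥0 → ℝ | ∃ s ≤ t, m < y s} from h)]
    obtain ⟨s, hst, hs⟩ := h
    exact tendsto_crossValue hx h0 hst hs continuousAt_const
  · rw [indicator_of_notMem (show x ∉ {y : ℝ≥0 → ℝ | ∃ s ≤ t, m < y s} from h)]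
    push Not at h
    refine tendsto_const_nhds.congr fun n ↦ ?_
    rw [crossValue_of_forall_le _ fun j hj ↦ h _ (grid_le t hj)]

lemma aemeasurable_firstCross (hB : IsPreBrownianReal B P) (γ m : ℝ) (t : ℝ≥0) (n j : ℕ) :
    NullMeasurableSet {ω | FirstCross (drifted B γ · ω) m t n j} P := by
  have h1 (s : ℝ≥0) : NullMeasurableSet {ω | drifted B γ s ω ≤ m} P :=
    nullMeasurableSet_le (aemeasurable_drifted hB γ s) aemeasurable_const
  have h2 (s : ℝ≥0) : NullMeasurableSet {ω | m < drifted B γ s ω} P :=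
    nullMeasurableSet_lt aemeasurable_const (aemeasurable_drifted hB γ s)
  have : {ω | FirstCross (drifted B γ · ω) m t n j}
      = (⋂ i, ⋂ (_ : i < j), {ω | drifted B γ (grid t n i) ω ≤ m})
        ∩ {ω | m < drifted B γ (grid t n j) ω} := by
    ext; simp [FirstCross]
  rw [this]
  exact (NullMeasurableSet.iInter fun i ↦ NullMeasurableSet.iInter fun _ ↦ h1 _).inter (h2 _)

lemma aemeasurable_ite_firstCross (hB : IsPreBrownianReal B P) (γ m : ℝ) (t : ℝ≥0) (n j : ℕ)
    {f : Ω → ENNReal} (hf : AEMeasurable f P)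
    [∀ ω, Decidable (FirstCross (drifted B γ · ω) m t n j)] :
    AEMeasurable (fun ω ↦ if FirstCross (drifted B γ · ω) m t n j then f ω else 0) P := by
  convert! hf.indicator₀ (aemeasurable_firstCross hB γ m t n j) using 1
  ext ω
  simp [indicator_apply]

open Classical in
/-- The expected value of a path functional on the grid converges with the mesh. -/
lemma tendsto_lintegral_crossValue [IsProbabilityMeasure P] (hB : IsPreBrownianReal B P)
    {γ m : ℝ} {t : ℝ≥0} {ψ : Ω → ℝ → ENNReal} {f : Ω → ENNReal}
    (hψ : ∀ n j, AEMeasurable (fun ω ↦ ψ ω (drifted B γ (grid t n j) ω)) P)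
    (hle : ∀ ω a, m < a → ψ ω a ≤ 1)
    (hf : ∀ᵐ ω ∂P, Tendsto (fun n ↦ crossValue (drifted B γ · ω) m t n (ψ ω)) atTop (𝓝 (f ω))) :
    Tendsto (fun n ↦ ∫⁻ ω, crossValue (drifted B γ · ω) m t n (ψ ω) ∂P) atTop
      (𝓝 (∫⁻ ω, f ω ∂P)) := by
  refine tendsto_lintegral_of_dominated_convergence' (fun _ ↦ 1) (fun n ↦ ?_) (fun n ↦ ?_)
    (by simp) hf
  · exact Finset.aemeasurable_fun_sum _
      fun j _ ↦ aemeasurable_ite_firstCross hB γ m t n j (hψ n j)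
  · refine Eventually.of_forall fun ω ↦ ?_
    rcases crossValue_cases (drifted B γ · ω) m t n (ψ ω) with ⟨a, ha, h⟩ | h
    · exact h.trans_le (hle ω a ha)
    · exact h.trans_le zero_le_one

/-- A strict inequality for a continuous path is an open condition, so countably many times suffice;
this is the source of measurability for events about the running maximum. -/
lemma exists_le_lt_iff_denseSeq {x : ℝ≥0 → ℝ} (hx : Continuous x) {m : ℝ} {t : ℝ≥0} :
    (∃ s ≤ t, m < x s) ↔ ∃ i, m < x (min t (TopologicalSpace.denseSeq ℝ≥0 i)) := by
  refine ⟨fun ⟨s, hst, hs⟩ ↦ ?_, fun ⟨i, hi⟩ ↦ ⟨_, min_le_left _ _, hi⟩⟩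
  have hopen : IsOpen {u | m < x (min t u)} := isOpen_lt continuous_const (by fun_prop)
  exact (TopologicalSpace.denseRange_denseSeq ℝ≥0).exists_mem_open hopen
    ⟨s, by simpa [min_eq_right hst] using hs⟩

lemma continuous_drifted {Ω : Type*} {B : ℝ≥0 → Ω → ℝ} (γ : ℝ) {ω : Ω}
    (h : Continuous (B · ω)) :
    Continuous (drifted B γ · ω) := by
  unfold drifted
  fun_prop

lemma nullMeasurableSet_exists_lt_drifted (hB : IsBrownianReal B P) (γ m : ℝ) (t : ℝ≥0) :
    NullMeasurableSet {ω | ∃ s ≤ t, m < drifted B γ s ω} P := by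
  have h (s : ℝ≥0) : NullMeasurableSet {ω | m < drifted B γ s ω} P :=
    nullMeasurableSet_lt aemeasurable_const (aemeasurable_drifted hB.toIsPreBrownianReal γ s)
  refine (NullMeasurableSet.iUnion fun i ↦
    h (min t (TopologicalSpace.denseSeq ℝ≥0 i))).congr ?_
  filter_upwards [hB.cont] with ω hω
  refine propext ?_
  change ω ∈ (⋃ _, _) ↔ ω ∈ {ω | _}
  rw [mem_iUnion]
  exact (exists_le_lt_iff_denseSeq (continuous_drifted γ hω)).symm

lemma ae_drifted_ne (hB : IsPreBrownianReal B P) (γ m : ℝ) {t : ℝ≥0} (ht : t ≠ 0) :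
    ∀ᵐ ω ∂P, drifted B γ t ω ≠ m := by
  have : NullSingletonClass (gaussianReal (γ * t) t) := nullSingletonClass_gaussianReal ht
  have h : ∀ᵐ x ∂(P.map (drifted B γ t)), x ≠ m := by
    rw [(hasLaw_drifted hB γ t).map_eq, ae_iff]
    simp
  exact ae_of_ae_map (aemeasurable_drifted hB γ t) h

lemma aemeasurable_indicator_drifted (hB : IsPreBrownianReal B P) (γ m : ℝ) (t : ℝ≥0) :
    AEMeasurable (fun ω ↦ (Iio m).indicator (1 : ℝ → ENNReal) (drifted B γ t ω)) P := by
  have h : Measurable ((Iio m).indicator (1 : ℝ → ENNReal)) :=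
    measurable_one.indicator measurableSet_Iio
  exact h.comp_aemeasurable (aemeasurable_drifted hB γ t)

lemma aemeasurable_reflWeight_drifted (hB : IsPreBrownianReal B P) (γ m : ℝ) (t s : ℝ≥0) :
    AEMeasurable (fun ω ↦ reflWeight γ m (drifted B γ t ω) (drifted B γ s ω)) P := by
  have h : AEMeasurable (fun ω ↦ (drifted B γ t ω, drifted B γ s ω)) P :=
    (aemeasurable_drifted hB γ t).prodMk (aemeasurable_drifted hB γ s)
  have h2 := (measurable_reflWeight γ m).comp_aemeasurable h
  simpa only [Function.comp_def] using h2

open Classical in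
lemma lintegral_crossValue_reflect [IsProbabilityMeasure P] (hB : IsPreBrownianReal B P)
    (γ m : ℝ) (t : ℝ≥0) (n : ℕ) :
    ∫⁻ ω, crossValue (drifted B γ · ω) m t n
        (fun _ ↦ (Iio m).indicator 1 (drifted B γ t ω)) ∂P
      = ∫⁻ ω, crossValue (drifted B γ · ω) m t n (reflWeight γ m (drifted B γ t ω)) ∂P := by
  have hc := aemeasurable_indicator_drifted hB γ m t
  have hw (j : ℕ) := aemeasurable_reflWeight_drifted hB γ m t (grid t n j)
  unfold crossValue
  rw [lintegral_finsetSum' _ fun j _ ↦ aemeasurable_ite_firstCross hB γ m t n j hc,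
    lintegral_finsetSum' _ fun j _ ↦ aemeasurable_ite_firstCross hB γ m t n j (hw j)]
  exact Finset.sum_congr rfl fun j hj ↦
    lintegral_firstCross_reflect hB γ m t (Finset.mem_range.1 hj)

/-- The reflection principle for a Brownian motion with drift. -/
theorem measure_exists_lt_drifted_and_lt [IsProbabilityMeasure P] (hB : IsBrownianReal B P)
    {γ m : ℝ} (hγ : 0 ≤ γ) (hm : 0 ≤ m) {t : ℝ≥0} (ht : t ≠ 0) :
    P ({ω | ∃ s ≤ t, m < drifted B γ s ω} ∩ {ω | drifted B γ t ω < m})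
      = ∫⁻ ω, (Ioi m).indicator (fun b ↦ ENNReal.ofReal (Real.exp (-2 * γ * (b - m))))
        (drifted B γ t ω) ∂P := by
  have hB' := hB.toIsPreBrownianReal
  have hXt := aemeasurable_drifted hB' γ t
  have hpath : ∀ᵐ ω ∂P, Continuous (drifted B γ · ω) ∧ drifted B γ 0 ω ≤ m := by
    filter_upwards [hB.cont, hB'.eval_zero_ae_eq_zero] with ω h1 h2
    exact ⟨continuous_drifted γ h1, by simpa [drifted, h2] using hm⟩
  have hc := aemeasurable_indicator_drifted hB' γ m t
  have hw (n j : ℕ) := aemeasurable_reflWeight_drifted hB' γ m t (grid t n j)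
  have hlim1 : Tendsto (fun n ↦ ∫⁻ ω, crossValue (drifted B γ · ω) m t n
      (fun _ ↦ (Iio m).indicator 1 (drifted B γ t ω)) ∂P) atTop
      (𝓝 (∫⁻ ω, {y : ℝ≥0 → ℝ | ∃ s ≤ t, m < y s}.indicator
        (fun _ ↦ (Iio m).indicator 1 (drifted B γ t ω)) (drifted B γ · ω) ∂P)) := by
    refine tendsto_lintegral_crossValue hB' (fun _ _ ↦ hc) (fun ω _ _ ↦ ?_) ?_
    · exact indicator_le_self' (f := (1 : ℝ → ENNReal)) (fun _ _ ↦ zero_le_one) _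
    · filter_upwards [hpath] with ω hω
      exact tendsto_crossValue_indicator hω.1 hω.2 _
  have hlim2 : Tendsto (fun n ↦ ∫⁻ ω, crossValue (drifted B γ · ω) m t n
      (reflWeight γ m (drifted B γ t ω)) ∂P) atTop
      (𝓝 (∫⁻ ω, (Ioi m).indicator (fun b ↦ ENNReal.ofReal (Real.exp (-2 * γ * (b - m))))
        (drifted B γ t ω) ∂P)) := by
    refine tendsto_lintegral_crossValue hB' hw (fun ω a ha ↦ reflWeight_le_one hγ _ ha) ?_
    filter_upwards [hpath, ae_drifted_ne hB' γ m ht] with ω hω hω'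
    exact tendsto_crossValue_reflWeight hω.1 γ hω.2 hω'
  -- The two expectations agree for each mesh by discrete reflection, so their limits agree.
  rw [← tendsto_nhds_unique
    (hlim1.congr fun n ↦ lintegral_crossValue_reflect hB' γ m t n) hlim2,
    ← lintegral_indicator_one₀ ((nullMeasurableSet_exists_lt_drifted hB γ m t).inter
      (nullMeasurableSet_lt hXt aemeasurable_const))]
  refine lintegral_congr fun ω ↦ ?_
  by_cases h1 : ∃ s ≤ t, m < drifted B γ s ω <;> by_cases h2 : drifted B γ t ω < m <;>
    simp [h1, h2]

/-! ### The law of the running maximum -/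

lemma gaussianReal_eq_map_std (μ : ℝ) (t : ℝ≥0) :
    gaussianReal μ t = (gaussianReal 0 1).map (fun x ↦ √t * x + μ) := by
  have h : (fun x : ℝ ↦ √t * x + μ) = (fun x ↦ x + μ) ∘ (fun x ↦ √t * x) := rfl
  rw [h, ← Measure.map_map (by fun_prop) (by fun_prop), gaussianReal_map_const_mul,
    gaussianReal_map_add_const]
  congr 1
  · simp
  · ext
    simp

lemma gaussianReal_Ioi (μ m : ℝ) {t : ℝ≥0} (ht : t ≠ 0) :
    gaussianReal μ t (Ioi m) = ENNReal.ofReal (stdTail ((m - μ) / √t)) := by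
  have hst : 0 < √(t : ℝ) := Real.sqrt_pos.2 (NNReal.coe_pos.2 (pos_iff_ne_zero.2 ht))
  rw [gaussianReal_eq_map_std, Measure.map_apply (by fun_prop) measurableSet_Ioi, stdTail,
    ofReal_measureReal]
  congr 1
  ext x
  simp only [mem_preimage, mem_Ioi, div_lt_iff₀ hst]
  constructor <;> intro h <;> linarith

/-- Undoing the weight by the change of sign x ↦ -x leaves exp(2γm) times the probability that the
endpoint lies below -m. -/
lemma lintegral_gaussianReal_indicator (γ m : ℝ) {t : ℝ≥0} (ht : t ≠ 0) :
    ∫⁻ x, (Ioi m).indicator (fun b ↦ ENNReal.ofReal (Real.exp (-2 * γ * (b - m)))) x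
      ∂(gaussianReal (γ * t) t) = ENNReal.ofReal (reflTail γ t m) := by
  have h := lintegral_gaussianReal_neg γ t
    (F := (Iio (-m)).indicator fun _ ↦ ENNReal.ofReal (Real.exp (2 * γ * m)))
    (measurable_const.indicator measurableSet_Iio)
  have hst : 0 < √(t : ℝ) := Real.sqrt_pos.2 (NNReal.coe_pos.2 (pos_iff_ne_zero.2 ht))
  rw [lintegral_indicator_const measurableSet_Iio] at h
  have hIio : gaussianReal (γ * t) t (Iio (-m))
      = ENNReal.ofReal (stdTail ((m + γ * t) / √t)) := by
    have hneg : gaussianReal (γ * t) t = (gaussianReal (-(γ * t)) t).map (fun x ↦ -x) := by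
      rw [gaussianReal_map_neg, neg_neg]
    rw [hneg, Measure.map_apply measurable_neg measurableSet_Iio]
    have : (fun x : ℝ ↦ -x) ⁻¹' Iio (-m) = Ioi m := by
      ext x
      simp
    rw [this, gaussianReal_Ioi _ _ ht, sub_neg_eq_add]
  rw [reflTail, ENNReal.ofReal_mul (Real.exp_pos _).le, ← hIio, h]
  refine lintegral_congr fun x ↦ ?_
  by_cases hx : m < x
  · rw [indicator_of_mem (show x ∈ Ioi m from hx),
      indicator_of_mem (show -x ∈ Iio (-m) from neg_lt_neg hx),
      ← ENNReal.ofReal_mul (Real.exp_pos _).le, ← Real.exp_add]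
    congr 2
    ring
  · rw [indicator_of_notMem (show x ∉ Ioi m from hx),
      indicator_of_notMem (show -x ∉ Iio (-m) from fun h ↦ hx (neg_lt_neg_iff.1 h)), zero_mul]

/-- The tail of the running maximum of a Brownian motion with nonnegative drift. -/
theorem measure_exists_lt_drifted [IsProbabilityMeasure P] (hB : IsBrownianReal B P)
    {γ m : ℝ} (hγ : 0 ≤ γ) (hm : 0 ≤ m) {t : ℝ≥0} (ht : t ≠ 0) :
    P {ω | ∃ s ≤ t, m < drifted B γ s ω} = ENNReal.ofReal (maxTail γ t m) := by
  have hB' := hB.toIsPreBrownianReal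
  have hlaw := hasLaw_drifted hB' γ t
  -- A path that ends above m has exceeded m, and ending exactly at m is a null event.
  have h1 : P ({ω | ∃ s ≤ t, m < drifted B γ s ω} \ {ω | drifted B γ t ω < m})
      = ENNReal.ofReal (stdTail ((m - γ * t) / √t)) := by
    rw [← gaussianReal_Ioi _ _ ht, ← hlaw.map_eq,
      Measure.map_apply_of_aemeasurable hlaw.aemeasurable measurableSet_Ioi]
    refine measure_congr ?_
    filter_upwards [ae_drifted_ne hB' γ m ht] with ω hω
    refine propext ⟨fun h ↦ ?_, fun h ↦ ⟨⟨t, le_rfl, h⟩,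
      fun (h' : drifted B γ t ω < m) ↦ lt_asymm (show m < drifted B γ t ω from h) h'⟩⟩
    exact lt_of_le_of_ne (not_lt.1 h.2) hω.symm
  have h2 : P ({ω | ∃ s ≤ t, m < drifted B γ s ω} ∩ {ω | drifted B γ t ω < m})
      = ENNReal.ofReal (reflTail γ t m) := by
    rw [measure_exists_lt_drifted_and_lt hB hγ hm ht, ← lintegral_gaussianReal_indicator γ m ht,
      ← hlaw.map_eq, lintegral_map' _ hlaw.aemeasurable]
    exact (Measurable.indicator (by fun_prop) measurableSet_Ioi).aemeasurable
  rw [← measure_inter_add_sdiff₀ _ (nullMeasurableSet_lt hlaw.aemeasurable aemeasurable_const), h1,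
    h2, ← ENNReal.ofReal_add (reflTail_nonneg _ _ _) (stdTail_nonneg _), maxTail, add_comm]

/-- Without drift, the probability of staying at or below k up to time n + 1 is 1 - 2 `stdTail`
(k/√(n+1)), which tends to 0. A nonnegative drift only raises the path. -/
lemma ae_forall_exists_lt_drifted [IsProbabilityMeasure P] (hB : IsBrownianReal B P) {γ : ℝ}
    (hγ : 0 ≤ γ) : ∀ᵐ ω ∂P, ∀ m : ℝ, ∃ s, m < drifted B γ s ω := by
  have hk (k : ℕ) : ∀ᵐ ω ∂P, ∃ s, (k : ℝ) < drifted B 0 s ω := by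
    rw [ae_iff]
    have hle (n : ℕ) : P {ω | ¬∃ s, (k : ℝ) < drifted B 0 s ω}
        ≤ ENNReal.ofReal (1 - maxTail 0 (n + 1 : ℝ≥0) k) := by
      have hne : ((n : ℝ≥0) + 1) ≠ 0 := by positivity
      have h := measure_exists_lt_drifted hB le_rfl (Nat.cast_nonneg k) hne
      have hcompl := prob_compl_eq_one_sub₀ (nullMeasurableSet_exists_lt_drifted hB 0 k (n + 1))
      rw [h, ← ENNReal.ofReal_one, ← ENNReal.ofReal_sub _
        (show 0 ≤ maxTail 0 (n + 1 : ℝ≥0) k from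
          add_nonneg (stdTail_nonneg _) (reflTail_nonneg _ _ _))] at hcompl
      rw [← hcompl]
      exact measure_mono fun ω hω ⟨s, _, hs⟩ ↦ hω ⟨s, hs⟩
    have hlim : Tendsto (fun n : ℕ ↦ ENNReal.ofReal (1 - maxTail 0 (n + 1 : ℝ≥0) k)) atTop
        (𝓝 0) := by
      have hdiv : Tendsto (fun n : ℕ ↦ (k : ℝ) / √(n + 1)) atTop (𝓝 0) :=
        tendsto_const_nhds.div_atTop (Real.tendsto_sqrt_atTop.comp
          (tendsto_atTop_add_const_right _ 1 tendsto_natCast_atTop_atTop))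
      have hcont : Tendsto (fun n : ℕ ↦ 1 - (stdTail ((k : ℝ) / √(n + 1))
          + stdTail ((k : ℝ) / √(n + 1)))) atTop (𝓝 (1 - (stdTail 0 + stdTail 0))) :=
        (((hasDerivAt_stdTail 0).continuousAt.tendsto.comp hdiv).add
          ((hasDerivAt_stdTail 0).continuousAt.tendsto.comp hdiv)).const_sub 1
      have h0 : 1 - (stdTail 0 + stdTail 0) = 0 := by
        have := stdTail_add_stdTail_neg 0
        rw [neg_zero] at this
        linarith
      rw [h0] at hcont
      have := ENNReal.tendsto_ofReal hcont
      rw [ENNReal.ofReal_zero] at this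
      refine this.congr fun n ↦ ?_
      simp [maxTail, reflTail]
    exact le_antisymm (ge_of_tendsto' hlim hle) zero_le
  filter_upwards [ae_all_iff.2 hk] with ω hω m
  obtain ⟨k, hk⟩ := exists_nat_ge m
  obtain ⟨s, hs⟩ := hω k
  refine ⟨s, (hk.trans_lt hs).trans_le ?_⟩
  have : 0 ≤ γ * s := by positivity
  simp only [drifted, zero_mul, add_zero]
  linarith

/-! ### The first hitting time as a rescaled running maximum -/

/-- The properties of the paths of a Brownian motion with drift used below. -/
structure IsGoodPath (x : ℝ≥0 → ℝ) : Prop where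
  cont : Continuous x
  zero : x 0 = 0
  unbounded : ∀ m, ∃ s, m < x s

lemma ae_isGoodPath [IsProbabilityMeasure P] (hB : IsBrownianReal B P) {γ : ℝ} (hγ : 0 ≤ γ) :
    ∀ᵐ ω ∂P, IsGoodPath (drifted B γ · ω) := by
  filter_upwards [hB.cont, hB.eval_zero_ae_eq_zero, ae_forall_exists_lt_drifted hB hγ]
    with ω h1 h2 h3
  exact ⟨continuous_drifted γ h1, by simp [drifted, h2], h3⟩

section Path

variable {Ω : Type*} {B : ℝ≥0 → Ω → ℝ} {δ γ : ℝ} {ω : Ω} {t : ℝ≥0}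

/-- Continuity keeps the path below the level slightly beyond t, which makes the inequality strict.
Unboundedness of the path is essential, since `sInf ∅ = 0` in `ℝ≥0`. -/
lemma lt_igSubordinator (hx : IsGoodPath (drifted B γ · ω)) {s : ℝ≥0}
    (h : ∀ u ≤ t, drifted B γ u ω < δ * s) : t < igSubordinator B δ γ s ω := by
  have hnhds : ∀ᶠ v in 𝓝 t, drifted B γ v ω < δ * s :=
    hx.cont.continuousAt.eventually_lt continuousAt_const (h t le_rfl)
  obtain ⟨v, hv, hIco⟩ := exists_Ico_subset_of_mem_nhds hnhds (exists_gt t)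
  refine hv.trans_le (le_csInf ?_ ?_)
  · obtain ⟨u, hu⟩ := hx.unbounded (max 0 (δ * s))
    refine ⟨u, pos_iff_ne_zero.2 ?_, (le_max_right _ _).trans_lt hu⟩
    rintro rfl
    rw [hx.zero] at hu
    exact absurd hu (not_lt.2 (le_max_left _ _))
  · rintro u ⟨-, hu⟩
    by_contra! huv
    rcases le_or_gt u t with hut | hut
    · exact absurd hu (not_lt.2 (h u hut).le)
    · have h' : drifted B γ u ω < δ * s := hIco ⟨hut.le, huv⟩
      exact absurd hu (not_lt.2 h'.le)

/-- This identifies the hitting time with the running maximum divided by δ and brings the problem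
back to the reflection principle. -/
lemma lt_igHitting_iff (hδ : 0 < δ) (hx : IsGoodPath (drifted B γ · ω)) {x : ℝ≥0} :
    x < igHitting B δ γ t ω ↔ ∃ s ≤ t, δ * x < drifted B γ s ω := by
  constructor
  · intro h
    by_contra! hle
    -- Any y > x gives a level strictly above the path, as `lt_igSubordinator` requires; then y
    -- bounds the infimum from above.
    refine absurd h (not_lt.2 (le_of_forall_gt_imp_ge_of_dense fun y hy ↦ ?_))
    refine csInf_le (OrderBot.bddBelow _) (lt_igSubordinator hx fun u hu ↦ ?_)
    refine (hle u hu).trans_lt (mul_lt_mul_of_pos_left ?_ hδ)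
    exact_mod_cast hy
  · rintro ⟨u, hut, hu⟩
    have hupos : 0 < u := by
      refine pos_iff_ne_zero.2 ?_
      rintro rfl
      rw [hx.zero] at hu
      exact absurd hu (not_lt.2 (by positivity))
    have hxu : (x : ℝ) < drifted B γ u ω / δ := by
      rw [lt_div_iff₀ hδ]
      linarith
    have hlt : x < (drifted B γ u ω / δ).toNNReal := by
      rwa [Real.lt_toNNReal_iff_coe_lt]
    refine hlt.trans_le (le_csInf ?_ ?_)
    -- The path is bounded on [0, t], so some level is not reached by time t and the set defining
    -- the hitting time is nonempty.
    · obtain ⟨K, hK⟩ := (isCompact_Icc (a := (0 : ℝ≥0)) (b := t)).bddAbove_image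
        hx.cont.continuousOn
      obtain ⟨n, hn⟩ := exists_nat_gt (K / δ)
      refine ⟨n, lt_igSubordinator hx fun v hv ↦ ?_⟩
      refine (hK (mem_image_of_mem _ ⟨zero_le, hv⟩)).trans_lt ?_
      rw [div_lt_iff₀ hδ] at hn
      rw [NNReal.coe_natCast]
      linarith
    · intro s hs
      rw [Real.toNNReal_le_iff_le_coe, div_le_iff₀ hδ]
      by_contra! hsu
      have : igSubordinator B δ γ s ω ≤ u :=
        csInf_le (OrderBot.bddBelow _) ⟨hupos, by rw [mul_comm]; exact hsu⟩
      exact absurd (show t < igSubordinator B δ γ s ω from hs) (not_lt.2 (this.trans hut))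

lemma igHitting_zero (hδ : 0 < δ) (hx : IsGoodPath (drifted B γ · ω)) :
    igHitting B δ γ 0 ω = 0 := by
  by_contra h
  obtain ⟨s, hs, h⟩ := (lt_igHitting_iff hδ hx).1 (pos_iff_ne_zero.2 h)
  rw [nonpos_iff_eq_zero.1 hs, hx.zero] at h
  simp at h

lemma tendsto_igHitting_zero (hδ : 0 < δ) (hx : IsGoodPath (drifted B γ · ω)) :
    Tendsto (fun t ↦ igHitting B δ γ t ω) (𝓝 0) (𝓝 0) := by
  refine tendsto_order.2 ⟨fun a ha ↦ absurd ha not_lt_zero, fun a ha ↦ ?_⟩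
  obtain ⟨b, hb0, hba⟩ := exists_between ha
  have hnhds : ∀ᶠ v in 𝓝 (0 : ℝ≥0), drifted B γ v ω < δ * b :=
    hx.cont.continuousAt.eventually_lt continuousAt_const (by rw [hx.zero]; positivity)
  obtain ⟨v, hv, hIco⟩ := exists_Ico_subset_of_mem_nhds hnhds (exists_gt 0)
  filter_upwards [Iio_mem_nhds hv] with t ht
  refine lt_of_le_of_lt (not_lt.1 fun h ↦ ?_) hba
  obtain ⟨s, hs, h⟩ := (lt_igHitting_iff hδ hx).1 h
  have h' : drifted B γ s ω < δ * b := hIco ⟨zero_le, hs.trans_lt ht⟩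
  exact absurd h (not_lt.2 h'.le)

end Path

/-- The first hitting time as a measurable function of the path of the Brownian motion. -/
def hittingFunctional (δ γ : ℝ) (t : ℝ≥0) (b : ℝ≥0 → ℝ) : ℝ≥0 :=
  (⨆ i, ENNReal.ofReal ((b (min t (TopologicalSpace.denseSeq ℝ≥0 i))
    + γ * (min t (TopologicalSpace.denseSeq ℝ≥0 i) : ℝ≥0)) / δ)).toNNReal

lemma measurable_hittingFunctional (δ γ : ℝ) (t : ℝ≥0) :
    Measurable (hittingFunctional δ γ t) := by
  unfold hittingFunctional
  fun_prop

/-- Independence of N and B is a statement about their paths, so the hitting time must be almost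
surely a function of the path of B that is measurable for the product σ-algebra. A countable
supremum provides one. -/
lemma igHitting_eq_hittingFunctional {Ω : Type*} {B : ℝ≥0 → Ω → ℝ} {δ γ : ℝ} {ω : Ω} (t : ℝ≥0)
    (hδ : 0 < δ) (hx : IsGoodPath (drifted B γ · ω)) :
    igHitting B δ γ t ω = hittingFunctional δ γ t (fun s ↦ B s ω) := by
  have h : (igHitting B δ γ t ω : ENNReal)
      = ⨆ i, ENNReal.ofReal ((B (min t (TopologicalSpace.denseSeq ℝ≥0 i)) ω
        + γ * (min t (TopologicalSpace.denseSeq ℝ≥0 i) : ℝ≥0)) / δ) := by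
    have hiff (x : ℝ≥0) : (x : ENNReal) < igHitting B δ γ t ω ↔
        (x : ENNReal) < ⨆ i, ENNReal.ofReal ((B (min t (TopologicalSpace.denseSeq ℝ≥0 i)) ω
          + γ * (min t (TopologicalSpace.denseSeq ℝ≥0 i) : ℝ≥0)) / δ) := by
      rw [ENNReal.coe_lt_coe, lt_igHitting_iff hδ hx, exists_le_lt_iff_denseSeq hx.cont,
        lt_iSup_iff]
      refine exists_congr fun i ↦ ?_
      rw [ENNReal.ofReal, ENNReal.coe_lt_coe, Real.lt_toNNReal_iff_coe_lt, lt_div_iff₀ hδ, mul_comm]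
      exact Iff.rfl
    exact le_antisymm (ENNReal.le_of_forall_nnreal_lt fun x hx ↦ ((hiff x).1 hx).le)
      (ENNReal.le_of_forall_nnreal_lt fun x hx ↦ ((hiff x).2 hx).le)
  rw [hittingFunctional, ← h, ENNReal.toNNReal_coe]

/-! ### The density of the first hitting time -/

/-- The density of the first hitting time at `x`. -/
def hittingPDF (δ γ x t : ℝ) : ℝ := δ * maxPDF γ t (δ * x)

lemma aemeasurable_hittingFunctional (hB : IsPreBrownianReal B P) (δ γ : ℝ) (t : ℝ≥0) :
    AEMeasurable (fun ω ↦ hittingFunctional δ γ t (fun s ↦ B s ω)) P := by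
  have h (s : ℝ≥0) := hB.aemeasurable s
  unfold hittingFunctional
  refine AEMeasurable.ennreal_toNNReal (AEMeasurable.iSup fun i ↦ ?_)
  exact (((h _).add_const _).div_const δ).ennreal_ofReal

lemma igHitting_ae_eq [IsProbabilityMeasure P] (hB : IsBrownianReal B P) {δ γ : ℝ} (hδ : 0 < δ)
    (hγ : 0 ≤ γ) (t : ℝ≥0) :
    (fun ω ↦ hittingFunctional δ γ t (fun s ↦ B s ω)) =ᵐ[P] igHitting B δ γ t := by
  filter_upwards [ae_isGoodPath hB hγ] with ω hω
  exact (igHitting_eq_hittingFunctional t hδ hω).symm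

lemma aemeasurable_igHitting [IsProbabilityMeasure P] (hB : IsBrownianReal B P) {δ γ : ℝ}
    (hδ : 0 < δ) (hγ : 0 ≤ γ) (t : ℝ≥0) : AEMeasurable (igHitting B δ γ t) P :=
  (aemeasurable_hittingFunctional hB.toIsPreBrownianReal δ γ t).congr (igHitting_ae_eq hB hδ hγ t)

lemma hittingPDF_nonneg {δ γ x t : ℝ} (hδ : 0 < δ) (hγ : 0 ≤ γ) (ht : 0 < t) (hx : 0 ≤ x) :
    0 ≤ hittingPDF δ γ x t :=
  mul_nonneg hδ.le (maxPDF_nonneg ht hγ (by positivity))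

lemma continuous_hittingPDF {t : ℝ} (δ γ : ℝ) (ht : 0 < t) :
    Continuous fun x ↦ hittingPDF δ γ x t := by
  have := continuous_maxPDF (γ := γ) ht
  unfold hittingPDF
  fun_prop

lemma integral_hittingPDF {t : ℝ} (δ γ : ℝ) (ht : 0 < t) (a : ℝ) :
    ∫ x in (0)..a, hittingPDF δ γ x t = 1 - maxTail γ t (δ * a) := by
  have hd (x : ℝ) : HasDerivAt (fun x ↦ -maxTail γ t (δ * x)) (hittingPDF δ γ x t) x := by
    have h := ((hasDerivAt_maxTail (γ := γ) ht (δ * x)).comp x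
      ((hasDerivAt_id x).const_mul δ)).neg
    convert! h using 1
    rw [hittingPDF]
    ring
  rw [intervalIntegral.integral_eq_sub_of_hasDerivAt (fun x _ ↦ hd x)
    ((continuous_hittingPDF δ γ ht).intervalIntegrable _ _), mul_zero, maxTail_zero]
  ring

/-- The first hitting time has a continuous density. -/
theorem isContinuousDensity_igHitting [IsProbabilityMeasure P] (hB : IsBrownianReal B P)
    {δ γ : ℝ} (hδ : 0 < δ) (hγ : 0 ≤ γ) {t : ℝ≥0} (ht : 0 < t) :
    IsContinuousDensity (fun x ↦ hittingPDF δ γ x t) (igHitting B δ γ t) P where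
  nonneg x hx := hittingPDF_nonneg hδ hγ (NNReal.coe_pos.2 ht) hx
  continuousOn := (continuous_hittingPDF δ γ (NNReal.coe_pos.2 ht)).continuousOn
  hasLaw := by
    have ht' : (0 : ℝ) < t := NNReal.coe_pos.2 ht
    have hmeas : AEMeasurable (fun ω ↦ (igHitting B δ γ t ω : ℝ)) P :=
      (aemeasurable_igHitting hB hδ hγ t).coe_nnreal_real
    refine ⟨hmeas, ?_⟩
    have hprob := Measure.isProbabilityMeasure_map hmeas
    -- The law is determined by its distribution function, which on a ≥ 0 is one minus the tail of
    -- the running maximum at δa.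
    refine Measure.ext_of_Iic _ _ fun a ↦ ?_
    rw [Measure.map_apply_of_aemeasurable hmeas measurableSet_Iic,
      withDensity_apply _ measurableSet_Iic, Measure.restrict_restrict measurableSet_Iic, inter_comm,
      Ici_inter_Iic]
    rcases lt_or_ge a 0 with ha | ha
    · have h0 : (fun ω ↦ (igHitting B δ γ t ω : ℝ)) ⁻¹' Iic a = ∅ := by
        refine eq_empty_of_forall_notMem fun ω hω ↦ ?_
        exact absurd ((NNReal.coe_nonneg _).trans hω) (not_le.2 ha)
      rw [h0, Icc_eq_empty (not_le.2 ha)]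
      simp
    · lift a to ℝ≥0 using ha
      have ha : (0 : ℝ) ≤ a := a.coe_nonneg
      have h1 : P ((fun ω ↦ (igHitting B δ γ t ω : ℝ)) ⁻¹' Iic a)
          = P {ω | ∃ s ≤ t, δ * a < drifted B γ s ω}ᶜ := by
        refine measure_congr ?_
        filter_upwards [ae_isGoodPath hB hγ] with ω hω
        have h := lt_igHitting_iff (t := t) (x := a) hδ hω
        rw [← NNReal.coe_lt_coe] at h
        have h' : (igHitting B δ γ t ω : ℝ) ≤ a ↔ ¬∃ s ≤ t, δ * a < drifted B γ s ω :=
          not_lt.symm.trans (not_congr h)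
        exact propext h'
      rw [h1, prob_compl_eq_one_sub₀ (nullMeasurableSet_exists_lt_drifted hB γ _ t),
        measure_exists_lt_drifted hB hγ (by positivity) ht.ne', ← ENNReal.ofReal_one,
        ← ENNReal.ofReal_sub _ (show 0 ≤ maxTail γ t (δ * a) from
          add_nonneg (stdTail_nonneg _) (reflTail_nonneg _ _ _)),
        ← integral_hittingPDF δ γ ht' a, intervalIntegral.integral_of_le ha,
        ← integral_Icc_eq_integral_Ioc, ofReal_integral_eq_lintegral_ofReal]
      · exact (continuous_hittingPDF δ γ ht').continuousOn.integrableOn_Icc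
      · filter_upwards [ae_restrict_mem measurableSet_Icc] with x hx
        exact hittingPDF_nonneg hδ hγ ht' hx.1

/-! ### Time changes of a Poisson process -/

/-- The mass of the Poisson law with parameter `l * x` at `k`. -/
def poissonMass (l : ℝ) (k : ℕ) (x : ℝ) : ℝ :=
  Real.exp (-(l * x)) * (l * x) ^ k / k.factorial

lemma poissonMass_eq (l x : ℝ≥0) (k : ℕ) :
    poissonMass l k x = (poissonMeasure (l * x)).real {k} := by
  rw [poissonMeasure_real_singleton, poissonMass]
  push_cast
  rfl

lemma poissonMass_nonneg (l x : ℝ≥0) (k : ℕ) : 0 ≤ poissonMass l k x := by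
  unfold poissonMass; positivity

lemma poissonMass_le_one (l x : ℝ≥0) (k : ℕ) : poissonMass l k x ≤ 1 := by
  rw [poissonMass_eq]
  exact measureReal_le_one

lemma continuous_poissonMass (l : ℝ) (k : ℕ) : Continuous (poissonMass l k) := by
  unfold poissonMass
  fun_prop

variable {N : ℝ≥0 → Ω → ℕ} {lam : ℝ≥0}

lemma IsPoissonProcess.hasLaw (hN : IsPoissonProcess N lam P) (s : ℝ≥0) :
    HasLaw (N s) (poissonMeasure (lam * s)) P := by
  have h := hN.hasLaw_sub 0 s zero_le
  rw [tsub_zero] at h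
  refine h.congr ?_
  filter_upwards [hN.eval_zero] with ω hω
  rw [hω, Nat.sub_zero]

lemma IsPoissonProcess.measure_eq (hN : IsPoissonProcess N lam P) (s : ℝ≥0) (k : ℕ) :
    P (N s ⁻¹' {k}) = ENNReal.ofReal (poissonMass lam k s) := by
  have h := hN.hasLaw s
  rw [← Measure.map_apply_of_aemeasurable h.aemeasurable (measurableSet_singleton k), h.map_eq,
    poissonMass_eq, ofReal_measureReal]

/-- The law of a sequence at an independent random index. -/
lemma measure_eval_index {J : Ω → ℕ} (hJ : AEMeasurable J P) {V : ℕ → Ω → ℕ}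
    (hV : ∀ j, AEMeasurable (V j) P) (hind : ∀ j, IndepFun (V j) J P) (k : ℕ) :
    P {ω | V (J ω) ω = k} = ∫⁻ ω, P (V (J ω) ⁻¹' {k}) ∂P := by
  have hunion : {ω | V (J ω) ω = k} = ⋃ j, V j ⁻¹' {k} ∩ J ⁻¹' {j} := by
    ext ω
    simp
  have hnull (j : ℕ) : NullMeasurableSet (V j ⁻¹' {k} ∩ J ⁻¹' {j}) P :=
    ((hV j).nullMeasurableSet_preimage (measurableSet_singleton k)).inter
      (hJ.nullMeasurableSet_preimage (measurableSet_singleton j))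
  have hdisj : Pairwise (Function.onFun (AEDisjoint P) fun j ↦ V j ⁻¹' {k} ∩ J ⁻¹' {j}) := by
    intro i j hij
    refine Disjoint.aedisjoint (Set.disjoint_left.2 fun ω hi hj ↦ hij ?_)
    exact (show J ω = i from hi.2).symm.trans hj.2
  rw [hunion, measure_iUnion₀ hdisj hnull,
    ← lintegral_map' (f := fun j ↦ P (V j ⁻¹' {k})) (measurable_of_countable _).aemeasurable hJ,
    lintegral_countable']
  refine tsum_congr fun j ↦ ?_
  rw [(hind j).measure_inter_preimage_eq_mul _ _ (measurableSet_singleton k)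
    (measurableSet_singleton j), Measure.map_apply_of_aemeasurable hJ (measurableSet_singleton j)]

lemma aemeasurable_eval_index {J : Ω → ℕ} (hJ : AEMeasurable J P) {V : ℕ → Ω → ℕ}
    (hV : ∀ j, AEMeasurable (V j) P) : AEMeasurable (fun ω ↦ V (J ω) ω) P := by
  have h : Measurable fun p : ℕ × (ℕ → ℕ) ↦ p.2 p.1 :=
    measurable_from_prod_countable_right fun j ↦ measurable_pi_apply j
  have h2 : AEMeasurable (fun ω ↦ (J ω, fun j ↦ V j ω)) P :=
    hJ.prodMk (aemeasurable_pi_lambda _ hV)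
  have h3 := h.comp_aemeasurable h2
  simpa only [Function.comp_def] using h3

/-- The law of a Poisson process at an independent random time. -/
theorem IsPoissonProcess.measureReal_timeChange [IsProbabilityMeasure P]
    (hN : IsPoissonProcess N lam P)
    (hNB : IndepFun (fun ω t ↦ N t ω) (fun ω t ↦ B t ω) P) {τ : (ℝ≥0 → ℝ) → ℝ≥0}
    (hτ : Measurable τ) {T : Ω → ℝ≥0} (hT : AEMeasurable T P)
    (hτT : (fun ω ↦ τ (fun s ↦ B s ω)) =ᵐ[P] T) (k : ℕ) :
    P.real {ω | N (T ω) ω = k} = ∫ ω, poissonMass lam k (T ω) ∂P := by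
  -- The shift j + 1 places the approximating time to the right of T, where the paths of N are known
  -- to be continuous. It takes countably many values, so independence can be used one value at a
  -- time.
  let pt (n j : ℕ) : ℝ≥0 := (j + 1) / (n + 1)
  let J (n : ℕ) (ω : Ω) : ℕ := ⌊(n + 1) * T ω⌋₊
  have hJ (n : ℕ) : AEMeasurable (J n) P :=
    Nat.measurable_floor.comp_aemeasurable (hT.const_mul _)
  have hNmeas (s : ℝ≥0) : AEMeasurable (N s) P := (hN.hasLaw s).aemeasurable
  have hind (n j : ℕ) : IndepFun (N (pt n j)) (J n) P := by
    have hφ : Measurable fun v : ℝ≥0 → ℕ ↦ v (pt n j) := measurable_pi_apply (pt n j)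
    have hψ : Measurable fun b : ℝ≥0 → ℝ ↦ ⌊(n + 1) * τ b⌋₊ := by fun_prop
    have h := hNB.comp hφ hψ
    refine h.congr (Eventually.of_forall fun ω ↦ rfl) ?_
    filter_upwards [hτT] with ω hω
    simp only [Function.comp_apply, J, ← hω]
  have happrox (n : ℕ) : P {ω | N (pt n (J n ω)) ω = k}
      = ∫⁻ ω, ENNReal.ofReal (poissonMass lam k (pt n (J n ω))) ∂P := by
    rw [measure_eval_index (hJ n) (fun j ↦ hNmeas (pt n j)) (hind n) k]
    exact lintegral_congr fun ω ↦ hN.measure_eq _ k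
  have hlt (n : ℕ) (ω : Ω) : T ω ≤ pt n (J n ω) := by
    simp only [pt]
    rw [le_div_iff₀ (by positivity), mul_comm]
    exact (Nat.lt_floor_add_one _).le
  have hle (n : ℕ) (ω : Ω) : pt n (J n ω) ≤ T ω + 1 / (n + 1) := by
    simp only [pt, add_div]
    gcongr
    rw [div_le_iff₀ (by positivity), mul_comm]
    exact Nat.floor_le zero_le
  have hlim (ω : Ω) : Tendsto (fun n ↦ pt n (J n ω)) atTop (𝓝 (T ω)) := by
    have h : Tendsto (fun n : ℕ ↦ T ω + 1 / ((n : ℝ≥0) + 1)) atTop (𝓝 (T ω + 0)) :=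
      tendsto_const_nhds.add tendsto_one_div_add_atTop_nhds_zero_nat
    rw [add_zero] at h
    exact tendsto_of_tendsto_of_tendsto_of_le_of_le tendsto_const_nhds h
      (fun n ↦ hlt n ω) (fun n ↦ hle n ω)
  have hNlim : ∀ᵐ ω ∂P, Tendsto (fun n ↦ N (pt n (J n ω)) ω) atTop (𝓝 (N (T ω) ω)) := by
    filter_upwards [hN.rightCont] with ω hω
    exact (hω (T ω)).tendsto.comp (tendsto_nhdsWithin_iff.2
      ⟨hlim ω, Eventually.of_forall fun n ↦ hlt n ω⟩)
  have hNn (n : ℕ) : AEMeasurable (fun ω ↦ N (pt n (J n ω)) ω) P :=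
    aemeasurable_eval_index (hJ n) fun j ↦ hNmeas (pt n j)
  have hNT : AEMeasurable (fun ω ↦ N (T ω) ω) P :=
    aemeasurable_of_tendsto_metrizable_ae _ hNn hNlim
  have hind1 {Y : Ω → ℕ} (hY : AEMeasurable Y P) :
      P {ω | Y ω = k} = ∫⁻ ω, ({k} : Set ℕ).indicator 1 (Y ω) ∂P := by
    rw [← lintegral_map' (f := ({k} : Set ℕ).indicator 1)
      (measurable_of_countable _).aemeasurable hY,
      lintegral_indicator_one (measurableSet_singleton k),
      Measure.map_apply_of_aemeasurable hY (measurableSet_singleton k)]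
    rfl
  have hL : Tendsto (fun n ↦ P {ω | N (pt n (J n ω)) ω = k}) atTop
      (𝓝 (P {ω | N (T ω) ω = k})) := by
    simp_rw [hind1 (hNn _), hind1 hNT]
    refine tendsto_lintegral_of_dominated_convergence' (fun _ ↦ 1) (fun n ↦ ?_)
      (fun n ↦ Eventually.of_forall fun ω ↦ ?_) (by simp) ?_
    · exact (measurable_of_countable (({k} : Set ℕ).indicator (1 : ℕ → ENNReal))).comp_aemeasurable
        (hNn n)
    · exact indicator_le_self' (f := (1 : ℕ → ENNReal)) (fun _ _ ↦ zero_le_one) _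
    · filter_upwards [hNlim] with ω hω
      exact (continuous_of_discreteTopology.tendsto _).comp hω
  have hcont : Continuous fun s : ℝ≥0 ↦ ENNReal.ofReal (poissonMass lam k s) :=
    ENNReal.continuous_ofReal.comp ((continuous_poissonMass lam k).comp NNReal.continuous_coe)
  have hR : Tendsto (fun n ↦ P {ω | N (pt n (J n ω)) ω = k}) atTop
      (𝓝 (∫⁻ ω, ENNReal.ofReal (poissonMass lam k (T ω)) ∂P)) := by
    simp_rw [happrox]
    refine tendsto_lintegral_of_dominated_convergence' (fun _ ↦ 1) (fun n ↦ ?_)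
      (fun n ↦ Eventually.of_forall fun ω ↦ ?_) (by simp)
      (Eventually.of_forall fun ω ↦ (hcont.tendsto _).comp (hlim ω))
    · exact (measurable_of_countable
        (fun j ↦ ENNReal.ofReal (poissonMass lam k (pt n j)))).comp_aemeasurable (hJ n)
    · exact ENNReal.ofReal_le_one.2 (poissonMass_le_one lam _ k)
  -- The discretized probabilities converge to one side by right continuity of N and to the other by
  -- continuity of the Poisson mass.
  rw [measureReal_def, tendsto_nhds_unique hL hR, integral_eq_lintegral_of_nonneg_ae]
  · exact Eventually.of_forall fun ω ↦ poissonMass_nonneg lam (T ω) k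
  · exact ((continuous_poissonMass lam k).measurable.comp_aemeasurable
      hT.coe_nnreal_real).aestronglyMeasurable

/-! ### Poisson masses at integers -/

/-- The mass of the Poisson law with parameter `l * x` at an integer. -/
def poissonMassInt (l : ℝ) (k : ℤ) (x : ℝ) : ℝ := if k < 0 then 0 else poissonMass l k.toNat x

lemma poissonMassInt_natCast (l : ℝ) (k : ℕ) : poissonMassInt l k = poissonMass l k := by
  ext x
  simp [poissonMassInt, not_lt.2 (Int.natCast_nonneg k)]

lemma poissonMassInt_of_neg (l : ℝ) {k : ℤ} (hk : k < 0) : poissonMassInt l k = 0 := by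
  ext x
  simp [poissonMassInt, hk]

/-- With the masses set to 0 at negative indices, the recursion has no exceptional case at k = 0 and
can be iterated to reach k - 2. -/
lemma hasDerivAt_poissonMassInt (l : ℝ) (k : ℤ) (x : ℝ) :
    HasDerivAt (poissonMassInt l k)
      (l * (poissonMassInt l (k - 1) x - poissonMassInt l k x)) x := by
  have he : HasDerivAt (fun x ↦ Real.exp (-(l * x))) (Real.exp (-(l * x)) * -l) x := by
    simpa using ((hasDerivAt_id x).const_mul l).neg.exp
  rcases lt_or_ge k 0 with hk | hk
  · rw [poissonMassInt_of_neg l hk, poissonMassInt_of_neg l (show k - 1 < 0 by omega)]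
    simp
  · lift k to ℕ using hk
    rcases k with _ | k
    · rw [poissonMassInt_natCast, poissonMassInt_of_neg l (show ((0 : ℕ) : ℤ) - 1 < 0 by omega)]
      convert! he using 1
      · ext x; simp [poissonMass]
      · simp [poissonMass]; ring
    · rw [show (((k + 1 : ℕ) : ℤ) - 1) = (k : ℕ) by push_cast; ring, poissonMassInt_natCast,
        poissonMassInt_natCast]
      have hp : HasDerivAt (fun x ↦ (l * x) ^ (k + 1)) ((k + 1 : ℕ) * (l * x) ^ k * l) x := by
        convert! ((hasDerivAt_id x).const_mul l).pow (k + 1) using 1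
        simp
      convert! (he.mul hp).div_const ((k + 1).factorial : ℝ) using 1
      simp only [poissonMass]
      rw [Nat.factorial_succ]
      push_cast
      have : (k.factorial : ℝ) ≠ 0 := by positivity
      have : (k : ℝ) + 1 ≠ 0 := by positivity
      field_simp
      ring

lemma continuous_poissonMassInt (l : ℝ) (k : ℤ) : Continuous (poissonMassInt l k) :=
  continuous_iff_continuousAt.2 fun x ↦ (hasDerivAt_poissonMassInt l k x).continuousAt

lemma abs_poissonMassInt_le_one (l : ℝ≥0) (k : ℤ) {x : ℝ} (hx : 0 ≤ x) :
    |poissonMassInt l k x| ≤ 1 := by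
  rcases lt_or_ge k 0 with hk | hk
  · simp [poissonMassInt_of_neg _ hk]
  · lift k to ℕ using hk
    lift x to ℝ≥0 using hx
    rw [poissonMassInt_natCast, abs_of_nonneg (poissonMass_nonneg l x k)]
    exact poissonMass_le_one l x k

lemma poissonMassInt_zero_right (l : ℝ) (k : ℤ) :
    poissonMassInt l k 0 = if k = 0 then 1 else 0 := by
  rcases lt_or_ge k 0 with hk | hk
  · simp [poissonMassInt_of_neg _ hk, hk.ne]
  · lift k to ℕ using hk
    rw [poissonMassInt_natCast]
    rcases k with _ | k
    · simp [poissonMass]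
    · have : ((k + 1 : ℕ) : ℤ) ≠ 0 := by omega
      rw [if_neg this]
      simp [poissonMass]

lemma pmfDerivZero_eq (l : ℝ) (k : ℕ) :
    l * (poissonMassInt l (k - 1) 0 - poissonMassInt l k 0) = pmfDerivZero l k := by
  rw [poissonMassInt_zero_right, poissonMassInt_zero_right, pmfDerivZero]
  rcases k with _ | _ | k
  · simp
  · simp
  · have h1 : ((k + 1 + 1 : ℕ) : ℤ) - 1 ≠ 0 := by omega
    have h2 : ((k + 1 + 1 : ℕ) : ℤ) ≠ 0 := by omega
    rw [if_neg h1, if_neg h2]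
    simp

lemma IsPoissonProcess.pmfProcess_eq (hN : IsPoissonProcess N lam P) (k : ℕ) {x : ℝ}
    (hx : 0 ≤ x) : pmfProcess N P k x = poissonMassInt lam k x := by
  lift x to ℝ≥0 using hx
  rw [poissonMassInt_natCast, pmfProcess, Real.toNNReal_coe, measureReal_def]
  have h : {ω | (N x ω : ℤ) = k} = N x ⁻¹' {k} := by
    ext ω
    simp
  rw [h, hN.measure_eq, ENNReal.toReal_ofReal (poissonMass_nonneg lam x k)]

lemma IsPoissonProcess.hasDerivWithinAt_pmfProcess (hN : IsPoissonProcess N lam P) (k : ℕ) :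
    HasDerivWithinAt (pmfProcess N P k) (pmfDerivZero lam k) (Ici 0) 0 := by
  have h := (hasDerivAt_poissonMassInt lam k 0).hasDerivWithinAt (s := Ici 0)
  rw [pmfDerivZero_eq] at h
  exact h.congr (fun x hx ↦ hN.pmfProcess_eq k hx) (hN.pmfProcess_eq k le_rfl)

/-! ### The mass functions of the time-changed process -/

section TimeChange

variable [IsProbabilityMeasure P] {δ γ : ℝ}

lemma pmfProcess_timeChange_eq_integral (hN : IsPoissonProcess N lam P) (hB : IsBrownianReal B P)
    (hNB : IndepFun (fun ω t ↦ N t ω) (fun ω t ↦ B t ω) P) (hδ : 0 < δ) (hγ : 0 ≤ γ)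
    (k : ℤ) (t : ℝ) :
    pmfProcess (timeChange N (igHitting B δ γ)) P k t
      = ∫ ω, poissonMassInt lam k (igHitting B δ γ t.toNNReal ω) ∂P := by
  rcases lt_or_ge k 0 with hk | hk
  · have h : {ω | (timeChange N (igHitting B δ γ) t.toNNReal ω : ℤ) = k} = ∅ := by
      refine eq_empty_of_forall_notMem fun ω (hω : _ = k) ↦ ?_
      omega
    simp [pmfProcess, h, poissonMassInt_of_neg _ hk]
  · lift k to ℕ using hk
    have h := hN.measureReal_timeChange hNB (measurable_hittingFunctional δ γ t.toNNReal)
      (aemeasurable_igHitting hB hδ hγ t.toNNReal) (igHitting_ae_eq hB hδ hγ t.toNNReal) k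
    rw [poissonMassInt_natCast, ← h, pmfProcess]
    simp only [timeChange, Nat.cast_inj]

/-- The substitution m = δx moves δ from the density into the test function, so that only the
density of the maximum depends on time. -/
lemma integral_igHitting (hB : IsBrownianReal B P) (hδ : 0 < δ) (hγ : 0 ≤ γ) {t : ℝ} (ht : 0 < t)
    {f : ℝ → ℝ} (hf : Continuous f) :
    ∫ ω, f (igHitting B δ γ t.toNNReal ω) ∂P = ∫ m in Ioi 0, f (m / δ) * maxPDF γ t m := by
  lift t to ℝ≥0 using ht.le
  rw [Real.toNNReal_coe]
  have hlaw := (isContinuousDensity_igHitting hB hδ hγ (NNReal.coe_pos.1 ht)).hasLaw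
  have hsub := integral_comp_mul_left_Ioi (fun m ↦ f (m / δ) * maxPDF γ t m) 0 hδ
  rw [mul_zero] at hsub
  have hc := continuous_hittingPDF δ γ ht
  rw [← integral_map (f := f) hlaw.aemeasurable hf.aestronglyMeasurable, hlaw.map_eq,
    integral_withDensity_eq_integral_toReal_smul hc.measurable.ennreal_ofReal
      (Eventually.of_forall fun x ↦ ENNReal.ofReal_lt_top), integral_Ici_eq_integral_Ioi]
  have h : ∫ x in Ioi 0, (ENNReal.ofReal (hittingPDF δ γ x t)).toReal • f x
      = ∫ x in Ioi 0, δ * (f (δ * x / δ) * maxPDF γ t (δ * x)) := by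
    refine setIntegral_congr_fun measurableSet_Ioi fun x hx ↦ ?_
    rw [ENNReal.toReal_ofReal (hittingPDF_nonneg hδ hγ ht (le_of_lt hx)), hittingPDF,
      mul_div_cancel_left₀ _ hδ.ne', smul_eq_mul]
    ring
  rw [h, integral_const_mul, hsub, smul_eq_mul, mul_inv_cancel_left₀ hδ.ne']

lemma abs_massFunction_le_one (X : ℝ≥0 → Ω → ℕ) (k : ℤ) (t : ℝ) :
    |(pmfProcess X P k t)| ≤ 1 := by
  rw [pmfProcess, abs_of_nonneg measureReal_nonneg]
  exact measureReal_le_one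

/-- The hitting time tends to 0 with t, and the Poisson masses are bounded and continuous. At
negative times `toNNReal` gives the value at 0, so continuity is two-sided. -/
lemma continuousAt_pmfProcess_timeChange (hN : IsPoissonProcess N lam P)
    (hB : IsBrownianReal B P) (hNB : IndepFun (fun ω t ↦ N t ω) (fun ω t ↦ B t ω) P)
    (hδ : 0 < δ) (hγ : 0 ≤ γ) (k : ℤ) :
    ContinuousAt (pmfProcess (timeChange N (igHitting B δ γ)) P k) 0 := by
  rw [show pmfProcess (timeChange N (igHitting B δ γ)) P k = fun t ↦
      ∫ ω, poissonMassInt lam k (igHitting B δ γ t.toNNReal ω) ∂P from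
    funext fun t ↦ pmfProcess_timeChange_eq_integral hN hB hNB hδ hγ k t]
  have hc := continuous_poissonMassInt (lam : ℝ) k
  refine tendsto_integral_filter_of_dominated_convergence (fun _ ↦ 1) ?_ ?_
    (integrable_const 1) ?_
  · exact Eventually.of_forall fun t ↦ (hc.measurable.comp_aemeasurable
      (aemeasurable_igHitting hB hδ hγ t.toNNReal).coe_nnreal_real).aestronglyMeasurable
  · exact Eventually.of_forall fun t ↦ Eventually.of_forall fun ω ↦
      abs_poissonMassInt_le_one lam k (NNReal.coe_nonneg _)
  · filter_upwards [ae_isGoodPath hB hγ] with ω hω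
    rw [Real.toNNReal_zero, igHitting_zero hδ hω]
    have h1 : Tendsto Real.toNNReal (𝓝 0) (𝓝 0) := by
      simpa using continuous_real_toNNReal.tendsto 0
    have h2 := (tendsto_igHitting_zero hδ hω).comp h1
    exact (hc.tendsto _).comp ((NNReal.continuous_coe.tendsto _).comp h2)

/-- The equation of the mass functions of the time-changed process at positive times. -/
theorem hasDerivAt_pmfProcess_timeChange (hN : IsPoissonProcess N lam P)
    (hB : IsBrownianReal B P) (hNB : IndepFun (fun ω t ↦ N t ω) (fun ω t ↦ B t ω) P)
    (hδ : 0 < δ) (hγ : 0 ≤ γ) (k : ℕ) {t : ℝ} (ht : 0 < t) :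
    HasDerivAt (pmfProcess (timeChange N (igHitting B δ γ)) P k)
      (ddeRight lam δ γ (pmfProcess (timeChange N (igHitting B δ γ)) P)
        (fun s ↦ hittingPDF δ γ 0 s) k t) t := by
  set q := pmfProcess (timeChange N (igHitting B δ γ)) P with hq
  set l : ℝ := (lam : ℝ) with hl
  have hl0 : 0 ≤ l := lam.coe_nonneg
  have hqI (j : ℤ) {s : ℝ} (hs : 0 < s) :
      q j s = ∫ m in Ioi 0, poissonMassInt l j (m / δ) * maxPDF γ s m := by
    rw [hq, pmfProcess_timeChange_eq_integral hN hB hNB hδ hγ,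
      integral_igHitting hB hδ hγ hs (continuous_poissonMassInt l j)]
  have hd (j : ℤ) (x : ℝ) : HasDerivAt (fun m ↦ poissonMassInt l j (m / δ))
      (l / δ * (poissonMassInt l (j - 1) (x / δ) - poissonMassInt l j (x / δ))) x := by
    convert! (hasDerivAt_poissonMassInt l j (x / δ)).comp x ((hasDerivAt_id x).div_const δ) using 1
    ring
  have hc (j : ℤ) : Continuous fun m ↦ poissonMassInt l j (m / δ) :=
    (continuous_poissonMassInt l j).comp (by fun_prop)
  have hb (j : ℤ) (x : ℝ) (hx : 0 ≤ x) : |poissonMassInt l j (x / δ)| ≤ 1 :=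
    abs_poissonMassInt_le_one lam j (by positivity)
  have hint (j : ℤ) : IntegrableOn (fun m ↦ poissonMassInt l j (m / δ) * maxPDF γ t m)
      (Ioi 0) := by
    refine Integrable.bdd_mul (c := 1) (integrableOn_maxPDF ht hγ)
      (hc j).aestronglyMeasurable ?_
    filter_upwards [ae_restrict_mem measurableSet_Ioi] with m hm using hb j m (le_of_lt hm)
  have hld : 0 ≤ l / δ := by positivity
  have hdiff (a b : ℤ) (x : ℝ) (hx : 0 ≤ x) :
      |poissonMassInt l a (x / δ) - poissonMassInt l b (x / δ)| ≤ 2 :=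
    (abs_sub _ _).trans (by linarith [hb a x hx, hb b x hx])
  -- The constant K adds up bounds for the test function and its two derivatives: 1, 2l/δ and
  -- 4(l/δ)².
  have hmain := hasDerivAt_integral_mul_maxPDF (t := t) ht hγ
    (p := fun m ↦ poissonMassInt l k (m / δ))
    (p' := fun m ↦ l / δ * (poissonMassInt l (k - 1) (m / δ) - poissonMassInt l k (m / δ)))
    (p'' := fun m ↦ l / δ * (l / δ * (poissonMassInt l (k - 1 - 1) (m / δ)
        - poissonMassInt l (k - 1) (m / δ))
      - l / δ * (poissonMassInt l (k - 1) (m / δ) - poissonMassInt l k (m / δ))))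
    (K := 1 + l / δ * 2 + l / δ * (l / δ * 2 + l / δ * 2))
    (hd k) (fun x ↦ ((hd (k - 1) x).sub (hd k x)).const_mul (l / δ))
    (by
      have := hc (k - 1 - 1)
      have := hc (k - 1)
      have := hc k
      fun_prop)
    (fun x hx ↦ by
      have h1 : 0 ≤ l / δ * 2 + l / δ * (l / δ * 2 + l / δ * 2) := by positivity
      linarith [hb k x hx])
    (fun x hx ↦ by
      have h1 : 0 ≤ l / δ * (l / δ * 2 + l / δ * 2) := by positivity
      rw [abs_mul, abs_of_nonneg hld]
      have h2 := mul_le_mul_of_nonneg_left (hdiff (k - 1) k x hx) hld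
      linarith)
    (fun x hx ↦ by
      have h1 : 0 ≤ l / δ * 2 := by positivity
      have h2 := mul_le_mul_of_nonneg_left (hdiff (k - 1) k x hx) hld
      have h3 := mul_le_mul_of_nonneg_left (hdiff (k - 1 - 1) (k - 1) x hx) hld
      rw [abs_mul, abs_of_nonneg hld]
      refine (mul_le_mul_of_nonneg_left ((abs_sub _ _).trans
        (add_le_add ?_ ?_)) hld).trans (by linarith :
          l / δ * (l / δ * 2 + l / δ * 2) ≤ _)
      · rwa [abs_mul, abs_of_nonneg hld]
      · rwa [abs_mul, abs_of_nonneg hld])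
  refine (hmain.congr_of_eventuallyEq ?_).congr_deriv ?_
  · filter_upwards [Ioi_mem_nhds ht] with s hs using hqI k hs
  · have h2 : (k : ℤ) - 1 - 1 = k - 2 := by ring
    -- Here ½ p'' + γ p' is expanded by the Poisson recursion and sorted by index.
    have hlin : ∫ m in Ioi 0, (1 / 2 * (l / δ * (l / δ * (poissonMassInt l (k - 1 - 1) (m / δ)
          - poissonMassInt l (k - 1) (m / δ))
        - l / δ * (poissonMassInt l (k - 1) (m / δ) - poissonMassInt l k (m / δ))))
        + γ * (l / δ * (poissonMassInt l (k - 1) (m / δ) - poissonMassInt l k (m / δ))))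
          * maxPDF γ t m
        = 1 / (2 * δ ^ 2) * (l ^ 2 - 2 * δ * γ * l) * q k t
          + 1 / (2 * δ ^ 2) * (-2 * l ^ 2 + 2 * δ * γ * l) * q (k - 1) t
          + 1 / (2 * δ ^ 2) * l ^ 2 * q (k - 2) t := by
      have hsum : IntegrableOn (fun m ↦ 1 / (2 * δ ^ 2) * (l ^ 2 - 2 * δ * γ * l)
            * (poissonMassInt l k (m / δ) * maxPDF γ t m)
          + 1 / (2 * δ ^ 2) * (-2 * l ^ 2 + 2 * δ * γ * l)
            * (poissonMassInt l (k - 1) (m / δ) * maxPDF γ t m)) (Ioi 0) :=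
        ((hint k).const_mul _).add ((hint (k - 1)).const_mul _)
      rw [hqI _ ht, hqI _ ht, hqI _ ht, ← integral_const_mul, ← integral_const_mul,
        ← integral_const_mul, ← integral_add ((hint _).const_mul _) ((hint _).const_mul _),
        ← integral_add hsum ((hint _).const_mul _),
        h2]
      refine integral_congr_ae (Eventually.of_forall fun m ↦ ?_)
      simp only []
      field_simp
      ring
    rw [hlin, ddeRight, ← pmfDerivZero_eq, hittingPDF, mul_zero, zero_div]
    field_simp

end TimeChange

/-! ### The boundary values of the density and the equation in the sense of distributions -/

lemma continuousOn_hittingPDF_zero (δ γ : ℝ) :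
    ContinuousOn (fun t ↦ hittingPDF δ γ 0 t) (Ioi 0) := fun _ ht ↦
  ((hasDerivAt_maxPDF_time ht (δ * 0)).const_mul δ).continuousAt.continuousWithinAt

/-- Dropping the reflected part and bounding the exponential by 1 shows that the boundary density is
at most 2δ t^{-1/2}. -/
lemma integrableOn_hittingPDF_zero {δ γ : ℝ} (hδ : 0 < δ) (hγ : 0 ≤ γ) (T : ℝ) :
    IntegrableOn (fun t ↦ hittingPDF δ γ 0 t) (Ioc 0 T) := by
  rcases le_or_gt T 0 with hT | hT
  · simp [Ioc_eq_empty (not_lt.2 hT)]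
  have hr : IntegrableOn (fun t : ℝ ↦ 2 * δ * t ^ (-(1 / 2) : ℝ)) (Ioc 0 T) := by
    have h := intervalIntegral.intervalIntegrable_rpow' (a := 0) (b := T) (r := -(1 / 2))
      (by norm_num)
    rw [intervalIntegrable_iff_integrableOn_Ioc_of_le hT.le] at h
    exact h.const_mul _
  refine Integrable.mono' hr (((continuousOn_hittingPDF_zero δ γ).mono
    Ioc_subset_Ioi_self).aestronglyMeasurable measurableSet_Ioc) ?_
  filter_upwards [ae_restrict_mem measurableSet_Ioc] with t ht
  have ht0 : 0 < t := ht.1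
  rw [Real.norm_of_nonneg (hittingPDF_nonneg hδ hγ ht0 le_rfl), hittingPDF, mul_comm 2 δ, mul_assoc]
  refine mul_le_mul_of_nonneg_left ((maxPDF_le hγ _).trans
    (mul_le_mul_of_nonneg_left ?_ two_pos.le)) hδ.le
  rw [driftPDF, Real.rpow_neg ht0.le, ← Real.sqrt_eq_rpow]
  have h1 : Real.exp (-(δ * 0 - γ * t) ^ 2 / (2 * t)) ≤ 1 := by
    rw [Real.exp_le_one_iff, neg_div, neg_nonpos]
    positivity
  have h2 : (√(2 * Real.pi * t))⁻¹ ≤ (√t)⁻¹ := by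
    have : t ≤ 2 * Real.pi * t := by nlinarith [Real.pi_gt_three]
    have := Real.sqrt_pos.2 ht0
    gcongr
  calc (√(2 * Real.pi * t))⁻¹ * Real.exp (-(δ * 0 - γ * t) ^ 2 / (2 * t))
      ≤ (√t)⁻¹ * 1 := by gcongr
    _ = _ := mul_one _

/-- A pointwise equation on `(0, ∞)` holds in the sense of distributions with a Dirac term. -/
lemma integral_mul_deriv_of_hasDerivAt {u R φ : ℝ → ℝ} (hu : ∀ t, 0 < t → HasDerivAt u (R t) t)
    (hu0 : ContinuousAt u 0) (hbdd : ∀ t, |u t| ≤ 1) (hR : ∀ T, IntegrableOn R (Ioc 0 T))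
    (hφ : ContDiff ℝ (⊤ : ℕ∞) φ) (hsupp : HasCompactSupport φ) :
    -(∫ t in Ioi 0, u t * deriv φ t) - u 0 * φ 0 = ∫ t in Ioi 0, R t * φ t := by
  have hdφ (t : ℝ) : HasDerivAt φ (deriv φ t) t := (hφ.differentiable (by simp) t).hasDerivAt
  have hcdφ : Continuous (deriv φ) := hφ.continuous_deriv (by simp)
  obtain ⟨T, hT⟩ : ∃ T, ∀ t, T < t → φ t = 0 := by
    obtain ⟨T, hT⟩ := hsupp.isCompact.bddAbove
    exact ⟨T, fun t ht ↦ by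
      by_contra h
      exact absurd (hT (subset_tsupport φ h)) (not_le.2 ht)⟩
  obtain ⟨C, hC⟩ := hsupp.exists_bound_of_continuous hφ.continuous
  have hcont : ContinuousOn u (Ioi 0) := fun t ht ↦ (hu t ht).continuousAt.continuousWithinAt
  have hI1 : IntegrableOn (fun t ↦ u t * deriv φ t) (Ioi 0) := by
    refine Integrable.bdd_mul (c := 1)
      (hcdφ.integrable_of_hasCompactSupport hsupp.deriv).integrableOn
      (hcont.aestronglyMeasurable measurableSet_Ioi) (Eventually.of_forall hbdd)
  have hI2 : IntegrableOn (fun t ↦ R t * φ t) (Ioi 0) := by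
    have h : IntegrableOn (fun t ↦ R t * φ t) (Ioc 0 T) :=
      Integrable.mul_bdd (c := C) (hR T) hφ.continuous.aestronglyMeasurable
        (Eventually.of_forall hC)
    refine h.of_forall_sdiff_eq_zero measurableSet_Ioi fun t ht ↦ ?_
    rw [hT t (not_le.1 fun h ↦ ht.2 ⟨ht.1, h⟩), mul_zero]
  have hlim : Tendsto (fun t ↦ u t * φ t) atTop (𝓝 0) := by
    refine tendsto_const_nhds.congr' ?_
    filter_upwards [eventually_gt_atTop T] with t ht
    rw [hT t ht, mul_zero]
  -- Differentiability is needed only on the open half-line; at 0 continuity suffices, which matters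
  -- because R may be unbounded there.
  have h := integral_Ioi_of_hasDerivAt_of_tendsto (a := 0) (f := fun t ↦ u t * φ t)
    (f' := fun t ↦ R t * φ t + u t * deriv φ t)
    (hu0.mul hφ.continuous.continuousAt).continuousWithinAt
    (fun t ht ↦ (hu t ht).mul (hdφ t)) (hI2.add hI1) hlim
  rw [integral_add hI2 hI1] at h
  linarith

lemma integrableOn_ddeRight {q : ℤ → ℝ → ℝ} {h₀ : ℝ → ℝ} (lam δ γ : ℝ) (k : ℕ) {T : ℝ}
    (hq : ∀ j, IntegrableOn (q j) (Ioc 0 T)) (hh : IntegrableOn h₀ (Ioc 0 T)) :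
    IntegrableOn (ddeRight lam δ γ q h₀ k) (Ioc 0 T) :=
  (((((hq k).const_mul _).add ((hq (k - 1)).const_mul _)).add
    ((hq (k - 2)).const_mul _)).const_mul _).add ((hh.const_mul _).mul_const _)

end IGHitting

end

theorem proposition2p2 {Ω : Type*} [MeasurableSpace Ω] (P : Measure Ω) [IsProbabilityMeasure P]
    (lam : ℝ≥0) (δ γ : ℝ) (hlam : 0 < lam) (hδ : 0 < δ) (hγ : 0 ≤ γ)
    (N : ℝ≥0 → Ω → ℕ) (B : ℝ≥0 → Ω → ℝ)
    (hN : IGHitting.IsPoissonProcess N lam P) (hB : IsBrownianReal B P)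
    (hNB : IndepFun (fun ω t ↦ N t ω) (fun ω t ↦ B t ω) P)
    (q : ℤ → ℝ → ℝ)
    (hq : q = IGHitting.pmfProcess (IGHitting.timeChange N (IGHitting.igHitting B δ γ)) P) :
    ∃ h : ℝ → ℝ → ℝ,
      -- `h x t` is the density of `H(t)` at `x`, continuous up to `x = 0`
      (∀ t : ℝ≥0, 0 < t →
        IGHitting.IsContinuousDensity (fun x ↦ h x t) (IGHitting.igHitting B δ γ t) P) ∧
      -- `t ↦ h(0, t)` is locally integrable on `[0, ∞)`
      (∀ T : ℝ, IntegrableOn (fun t ↦ h 0 t) (Ioc 0 T)) ∧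
      ∀ k : ℕ,
        -- the values of `p_k'(0)`
        HasDerivWithinAt (IGHitting.pmfProcess N P k) (IGHitting.pmfDerivZero lam k) (Ici 0) 0 ∧
        -- the equation for `t > 0`, where the Dirac term vanishes
        (∀ t : ℝ, 0 < t →
          HasDerivAt (q k) (IGHitting.ddeRight lam δ γ q (fun s ↦ h 0 s) k t) t) ∧
        -- the equation on the whole line, in the sense of distributions, for the mass function
        -- extended by zero to negative times
        (∀ φ : ℝ → ℝ, ContDiff ℝ (⊤ : ℕ∞) φ → HasCompactSupport φ →
          -(∫ t in Ioi 0, q k t * deriv φ t) - q k 0 * φ 0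
            = ∫ t in Ioi 0, IGHitting.ddeRight lam δ γ q (fun s ↦ h 0 s) k t * φ t) := by
  subst hq
  have hder (k : ℕ) {t : ℝ} (ht : 0 < t) :=
    IGHitting.hasDerivAt_pmfProcess_timeChange hN hB hNB hδ hγ k ht
  have hint := IGHitting.integrableOn_hittingPDF_zero hδ hγ
  refine ⟨IGHitting.hittingPDF δ γ,
    fun t ht ↦ IGHitting.isContinuousDensity_igHitting hB hδ hγ ht, hint,
    fun k ↦ ⟨hN.hasDerivWithinAt_pmfProcess k, fun t ht ↦ hder k ht, fun φ hφ hsupp ↦ ?_⟩⟩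
  refine IGHitting.integral_mul_deriv_of_hasDerivAt (fun t ht ↦ hder k ht)
    (IGHitting.continuousAt_pmfProcess_timeChange hN hB hNB hδ hγ k)
    (IGHitting.abs_massFunction_le_one _ _)
    (fun T ↦ IGHitting.integrableOn_ddeRight _ _ _ k (fun j ↦ ?_) (hint T)) hφ hsupp
  -- Continuity on (0, T] serves only for measurability; with the bound by 1 it gives integrability
  -- of each mass function. At j < 0 the function vanishes, and at j ≥ 0 it is differentiable.
  have hcont : ContinuousOn
      (IGHitting.pmfProcess (IGHitting.timeChange N (IGHitting.igHitting B δ γ)) P j) (Ioc 0 T) := by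
    rcases lt_or_ge j 0 with hj | hj
    · have h0 (t : ℝ) : IGHitting.pmfProcess
          (IGHitting.timeChange N (IGHitting.igHitting B δ γ)) P j t = 0 := by
        simp [IGHitting.pmfProcess_timeChange_eq_integral hN hB hNB hδ hγ,
          IGHitting.poissonMassInt_of_neg _ hj]
      exact continuousOn_const.congr fun t _ ↦ h0 t
    · lift j to ℕ using hj
      exact fun t ht ↦ (hder j ht.1).continuousAt.continuousWithinAt
  exact IntegrableOn.of_bound (by simp)
    (hcont.aestronglyMeasurable measurableSet_Ioc)
    1 (Filter.Eventually.of_forall (IGHitting.abs_massFunction_le_one _ _))
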